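/- Let $d$ be a natural number. Let $H^2(\mathbb D^d)$ be the Hardy space of functions $f(z)=\sum_{\alpha\in\mathbb N_0^d}a_\alpha z^\alpha$ on the polydisc $\mathbb D^d$ with $\sum_\alpha|a_\alpha|^2<\infty$, with inner product $\langle\sum a_\alpha z^\alpha,\sum b_\alpha z^\alpha\rangle_2=\sum a_\alpha\overline{b_\alpha}$, and let $M_{z_i}$ be multiplication by $z_i$ on $H^2(\mathbb D^d)$. For a holomorphic function $f$ on $\mathbb D^d$ let $$\|f\|_{\mathrm{SA}}=\sup\{\|f(T)\| : T=(T_1,\dots,T_d)\text{ commuting operators on a complex Hilbert space},\ \|T_i\|<1\}\in[0,\infty],$$ where $f(T)$ is defined by inserting $T$ into the power series of $f$ at $0$, and let $\mathcal{SA}_d$ be the space of all holomorphic $f$ on $\mathbb D^d$ with $\|f\|_{\mathrm{SA}}<\infty$. Let $$\mathcal L_c=\{L\in\mathcal B(H^2(\mathbb D^d)) : L\ge 0,\ M_{z_i}^*LM_{z_i}\le L,\ i=1,\dots,d\}.$$ For $g\in H^2(\mathbb D^d)$ let $g\otimes g$ be the operator $h\mapsto\langle h,g\rangle_2\,g$,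 let $\mathcal L_c(g)=\{L\in\mathcal L_c : L\ge g\otimes g\}$, and define the dual Schur--Agler norm $$\|g\|_*=\inf\{\langle L1,1\rangle_2^{1/2} : L\in\mathcal L_c(g)\}.$$ Let $P_n$ be the space of homogeneous polynomials of degree $n$ in $d$ variables. Let $\mathcal L_c^{(n)}$ be the set of all $L\in\mathcal L_c$ of the form $L=\sum_{k=0}^nL_k$ with $L_k\in\mathcal B(P_k)$ (extended by $0$ to $P_k^\perp$), and for $q\in P_n$ let $\mathcal L_c^{(n)}(q)$ be the set of all $L=\sum_{k=0}^nL_k\in\mathcal L_c^{(n)}$ with $L\ge q\otimes q$ and $L_n=q\otimes q$. (1) $\|\cdot\|_*$ is a norm on $H^2(\mathbb D^d)$, and for each $f\in H^2(\mathbb D^d)$ $$\|f\|_{\mathrm{SA}}=\sup\{|\langle f,g\rangle_2| : g\in H^2(\mathbb D^d),\ \|g\|_*\le1\},$$ where both sides may be infinite. Moreover $\|\cdot\|_{\mathrm{SA}}$ is a norm on $\mathcal{SA}_d$, $\mathcal{SA}_d\subseteq H^2(\mathbb D^d)$, and the map $$\mathcal{SA}_d\to(H^2(\mathbb D^d),\|\cdot\|_*)^*,\qquad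 f\mapsto\langle\cdot,f\rangle_2,$$ is a conjugate-linear isometric isomorphism. (2) Let $n\ge0$. If $q\in P_n$, then $$\|q\|_*=\inf\{\langle L1,1\rangle_2^{1/2} : L\in\mathcal L_c^{(n)},\ L\ge q\otimes q\}=\inf\{\langle L1,1\rangle_2^{1/2} : L\in\mathcal L_c^{(n)}(q)\}.$$ For $p\in P_n$, $p\in\mathcal{SA}_d$ and $$\|p\|_{\mathrm{SA}}=\sup\{|\langle p,q\rangle_2| : q\in P_n,\ \|q\|_*\le1\},$$ and the map $(P_n,\|\cdot\|_{\mathrm{SA}})\to(P_n,\|\cdot\|_*)^*$, $p\mapsto\langle\cdot,p\rangle_2$, is a conjugate-linear isometric isomorphism. -/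

import Mathlib

namespace SchurAgler

noncomputable section

/-- The open unit polydisc. -/
def polydisc (d : ℕ) : Set (Fin d → ℂ) := {z | ∀ i, ‖z i‖ < 1}

/-- The value `z ^ α` of the monomial with multi-index `α`. -/
def mpow {d : ℕ} (z : Fin d → ℂ) (α : Fin d → ℕ) : ℂ := ∏ i, z i ^ α i

theorem mpow_cons {d : ℕ} (t : ℂ) (w : Fin d → ℂ) (n : ℕ) (β : Fin d → ℕ) :
    mpow (Fin.cons t w : Fin (d + 1) → ℂ) (Fin.cons n β : Fin (d + 1) → ℕ) =
      t ^ n * mpow w β := by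
  simp [mpow, Fin.prod_univ_succ]

/-- The multi-geometric series. -/
theorem hasSum_geometric : ∀ {d : ℕ} (x : Fin d → ℂ), (∀ i, ‖x i‖ < 1) →
    HasSum (fun α => mpow x α) (∏ i, (1 - x i)⁻¹)
  | 0, x, _ => by
    have : ∀ α : Fin 0 → ℕ, mpow x α = 1 := fun α => by simp [mpow]
    simp [this]
  | d + 1, x, hx => by
    have h1 := hasSum_geometric_of_norm_lt_one (hx 0)
    have h2 := hasSum_geometric (Fin.tail x) (fun i => hx i.succ)
    have h3 := h1.mul h2 (summable_mul_of_summable_norm h1.summable.norm h2.summable.norm)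
    rw [Fin.prod_univ_succ, ← (Fin.consEquiv (fun _ => ℕ)).hasSum_iff]
    have h4 : (fun α => mpow x α) ∘ (Fin.consEquiv (fun _ => ℕ)) =
        fun p : ℕ × (Fin d → ℕ) => x 0 ^ p.1 * mpow (Fin.tail x) p.2 := by
      funext p
      rw [← mpow_cons, Fin.cons_self_tail]
      rfl
    rw [h4]
    exact h3

theorem summable_geometric {d : ℕ} (x : Fin d → ℝ) (h0 : ∀ i, 0 ≤ x i) (hx : ∀ i, x i < 1) :
    Summable (fun α : Fin d → ℕ => ∏ i, x i ^ α i) := by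
  have h := (hasSum_geometric (fun i => (x i : ℂ)) (fun i => by
    rw [Complex.norm_real, Real.norm_of_nonneg (h0 i)]; exact hx i)).summable
  rw [← Complex.summable_ofReal]
  simpa [mpow] using h

/-- A power series that vanishes identically near the origin is zero. -/
theorem coeff_eq_zero : ∀ {d : ℕ} {ρ : ℝ}, 0 < ρ → ∀ (a : (Fin d → ℕ) → ℂ),
    (∀ z : Fin d → ℂ, (∀ i, ‖z i‖ < ρ) → HasSum (fun α => a α * mpow z α) 0) → a = 0
  | 0, ρ, _, a, h => by
    funext α
    have h1 := h 0 (fun i => i.elim0)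
    have h2 := hasSum_single (f := fun α => a α * mpow 0 α) α
      (fun b hb => absurd (Subsingleton.elim b α) hb)
    have h3 : a α * mpow 0 α = 0 := h2.unique h1
    simpa only [mpow, Finset.univ_eq_empty, Finset.prod_empty, mul_one, Pi.zero_apply] using h3
  | d + 1, ρ, hρ, a, h => by
    have key : ∀ n (β : Fin d → ℕ), a (Fin.cons n β : Fin (d + 1) → ℕ) = 0 := by
      have hs : ∀ t : ℂ, ‖t‖ < ρ → ∀ w : Fin d → ℂ, (∀ i, ‖w i‖ < ρ) →
          HasSum (fun p : ℕ × (Fin d → ℕ) =>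
            t ^ p.1 * (a (Fin.cons p.1 p.2 : Fin (d + 1) → ℕ) * mpow w p.2)) 0 := by
        intro t ht w hw
        have h1 := h (Fin.cons t w : Fin (d + 1) → ℂ) (by
          intro i; refine Fin.cases ?_ (fun j => ?_) i
          · simpa using ht
          · simpa using hw j)
        rw [← (Fin.consEquiv (fun _ => ℕ)).hasSum_iff] at h1
        convert h1 using 2 with p
        change _ = a (Fin.cons p.1 p.2 : Fin (d + 1) → ℕ) *
          mpow (Fin.cons t w : Fin (d + 1) → ℂ) (Fin.cons p.1 p.2 : Fin (d + 1) → ℕ)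
        rw [mpow_cons]; ring
      have hsum : ∀ w : Fin d → ℂ, (∀ i, ‖w i‖ < ρ) → ∀ n,
          Summable (fun β : Fin d → ℕ => a (Fin.cons n β : Fin (d + 1) → ℕ) * mpow w β) := by
        intro w hw n
        have ht0 : ((ρ / 2 : ℝ) : ℂ) ≠ 0 := by
          exact_mod_cast (half_pos hρ).ne'
        have h1 := (hs ((ρ / 2 : ℝ) : ℂ) (by
          rw [Complex.norm_real, Real.norm_of_nonneg (half_pos hρ).le]; linarith) w hw).summable
        have h2 := h1.prod_factor n
        exact (summable_mul_left_iff (pow_ne_zero n ht0)).1 h2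
      intro n
      have hn : ∀ w : Fin d → ℂ, (∀ i, ‖w i‖ < ρ) →
          ∀ n, ∑' β : Fin d → ℕ, a (Fin.cons n β : Fin (d + 1) → ℕ) * mpow w β = 0 := by
        intro w hw
        set c : ℕ → ℂ := fun n =>
          ∑' β : Fin d → ℕ, a (Fin.cons n β : Fin (d + 1) → ℕ) * mpow w β with hc
        let p : FormalMultilinearSeries ℂ ℂ ℂ :=
          fun n => ContinuousMultilinearMap.mkPiRing ℂ (Fin n) (c n)
        have h1 : HasFPowerSeriesAt (0 : ℂ → ℂ) p 0 := by
          rw [hasFPowerSeriesAt_iff]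
          filter_upwards [Metric.ball_mem_nhds (0 : ℂ) hρ] with t ht
          have h2 := (hs t (by simpa using ht) w hw).prod_fiberwise
            (fun n => ((hsum w hw n).hasSum.mul_left (t ^ n)))
          have h3 : ∀ n, p.coeff n = c n := fun n => by
            simp [FormalMultilinearSeries.coeff, p]
          simpa only [h3, smul_eq_mul, Pi.zero_apply] using h2
        have h2 := h1.eq_zero
        intro n
        have h3 := congrArg (fun p : FormalMultilinearSeries ℂ ℂ ℂ => p n 1) h2
        simpa [p] using h3
      have h4 := coeff_eq_zero hρ (fun β => a (Fin.cons n β : Fin (d + 1) → ℕ))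
        (fun w hw => (hn w hw n) ▸ (hsum w hw n).hasSum)
      exact fun β => congrFun h4 β
    funext α
    rw [← Fin.cons_self_tail α]
    exact key _ _

theorem torusMap_mem {d : ℕ} {r : ℝ} (h0 : 0 < r) (h1 : r < 1) (θ : Fin d → ℝ) :
    torusMap 0 (fun _ => r) θ ∈ polydisc d := by
  intro i
  simpa [torusMap, Complex.norm_exp_ofReal_mul_I, abs_of_pos h0] using h1

theorem continuous_torus {d : ℕ} (r : ℝ) :
    Continuous (torusMap (0 : Fin d → ℂ) (fun _ => r)) := by
  unfold torusMap
  fun_prop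

theorem norm_torusMap {d : ℕ} {r : ℝ} (h0 : 0 < r) (θ : Fin d → ℝ) (i : Fin d) :
    ‖torusMap 0 (fun _ => r) θ i‖ = r := by
  simp [torusMap, Complex.norm_exp_ofReal_mul_I, abs_of_pos h0]

theorem sub_ne_zero_torus {d : ℕ} {r : ℝ} (h0 : 0 < r) {z : Fin d → ℂ} (hz : ∀ i, ‖z i‖ < r)
    (θ : Fin d → ℝ) (i : Fin d) : torusMap 0 (fun _ => r) θ i - z i ≠ 0 := by
  intro h
  have := norm_torusMap h0 θ i
  rw [sub_eq_zero.1 h] at this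
  exact (hz i).ne this

theorem continuous_comp_torus {d : ℕ} {r : ℝ} (h0 : 0 < r) (h1 : r < 1)
    {f : (Fin d → ℂ) → ℂ} (hf : DifferentiableOn ℂ f (polydisc d)) :
    Continuous (fun θ : Fin d → ℝ => f (torusMap 0 (fun _ => r) θ)) :=
  hf.continuousOn.comp_continuous (continuous_torus r) (torusMap_mem h0 h1)

/-- The Cauchy integral formula on a polydisc. -/
theorem cauchy_formula : ∀ {d : ℕ} {r : ℝ}, 0 < r → r < 1 → ∀ {f : (Fin d → ℂ) → ℂ},
    DifferentiableOn ℂ f (polydisc d) → ∀ {z : Fin d → ℂ}, (∀ i, ‖z i‖ < r) →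
    torusIntegral (fun ζ => (∏ i, (ζ i - z i))⁻¹ * f ζ) 0 (fun _ => r) =
      (2 * Real.pi * Complex.I) ^ d * f z
  | 0, r, _, _, f, _, z, _ => by
    rw [torusIntegral_dim0]
    simp [Subsingleton.elim z 0]
  | d + 1, r, h0, h1, f, hf, z, hz => by
    have hint : TorusIntegrable (fun ζ => (∏ i, (ζ i - z i))⁻¹ * f ζ) 0 (fun _ => r) := by
      refine Continuous.integrableOn_Icc ?_
      refine Continuous.mul ?_ (continuous_comp_torus h0 h1 hf)
      refine Continuous.inv₀ ?_ fun θ =>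
        Finset.prod_ne_zero_iff.2 fun i _ => sub_ne_zero_torus h0 hz θ i
      refine continuous_finsetProd _ fun i _ => ?_
      exact ((continuous_apply i).comp (continuous_torus r)).sub continuous_const
    rw [torusIntegral_succ hint]
    have hcons : ∀ (x : ℂ) (y : Fin d → ℂ), ‖x‖ < 1 → y ∈ polydisc d →
        (Fin.cons x y : Fin (d + 1) → ℂ) ∈ polydisc (d + 1) := by
      intro x y hx hy i
      refine Fin.cases ?_ (fun j => ?_) i
      · simpa using hx
      · simpa using hy j
    have hin : Set.EqOn
        (fun x => torusIntegral (fun y : Fin d → ℂ =>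
          (∏ i, ((Fin.cons x y : Fin (d + 1) → ℂ) i - z i))⁻¹ *
            f (Fin.cons x y : Fin (d + 1) → ℂ)) 0 (fun _ => r))
        (fun x => (x - z 0)⁻¹ • ((2 * Real.pi * Complex.I) ^ d *
          f (Fin.cons x (Fin.tail z) : Fin (d + 1) → ℂ))) (Metric.sphere 0 r) := by
      intro x hx
      have hx' : ‖x‖ < 1 := by
        rw [mem_sphere_zero_iff_norm] at hx
        linarith
      have hfx : DifferentiableOn ℂ (fun y : Fin d → ℂ => f (Fin.cons x y : Fin (d + 1) → ℂ))
          (polydisc d) := by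
        refine hf.comp ?_ fun y hy => hcons x y hx' hy
        refine Differentiable.differentiableOn ?_
        rw [differentiable_pi]
        intro i
        refine Fin.cases ?_ (fun j => ?_) i
        · simp
        · simpa using differentiable_apply j
      have hc := cauchy_formula h0 h1 hfx (z := Fin.tail z) (fun i => hz i.succ)
      simp only [smul_eq_mul]
      rw [← hc, ← torusIntegral_const_mul]
      congr 1
      funext y
      rw [Fin.prod_univ_succ, mul_inv, mul_assoc]
      rfl
    have hcirc := circleIntegral.integral_congr (c := (0 : ℂ)) h0.le hin
    refine hcirc.trans ?_
    have hg : DifferentiableOn ℂ (fun x : ℂ => (2 * Real.pi * Complex.I) ^ d *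
        f (Fin.cons x (Fin.tail z) : Fin (d + 1) → ℂ)) (Metric.closedBall 0 r) := by
      refine DifferentiableOn.const_mul (hf.comp ?_ fun x hx => hcons x _ ?_ ?_) _
      · refine Differentiable.differentiableOn ?_
        rw [differentiable_pi]
        intro i
        refine Fin.cases ?_ (fun j => ?_) i
        · simp
        · simp
      · rw [mem_closedBall_zero_iff] at hx
        linarith
      · exact fun i => (hz i.succ).trans h1
    rw [hg.circleIntegral_sub_inv_smul (by simpa using hz 0), Fin.cons_self_tail, smul_eq_mul]
    ring

/-- A holomorphic function on the polydisc has, on each smaller polydisc, a power series. -/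
theorem exists_hasSum_of_lt {d : ℕ} {r : ℝ} (h0 : 0 < r) (h1 : r < 1) {f : (Fin d → ℂ) → ℂ}
    (hf : DifferentiableOn ℂ f (polydisc d)) :
    ∃ a : (Fin d → ℕ) → ℂ, ∀ z : Fin d → ℂ, (∀ i, ‖z i‖ < r) →
      HasSum (fun α => a α * mpow z α) (f z) := by
  set c : ℂ := (2 * Real.pi * Complex.I) ^ d with hc
  have hc0 : c ≠ 0 := pow_ne_zero _ Complex.two_pi_I_ne_zero
  refine ⟨fun α => c⁻¹ * torusIntegral (fun ζ => (∏ i, ζ i ^ (α i + 1))⁻¹ * f ζ) 0 (fun _ => r),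
    fun z hz => ?_⟩
  have hfz : f z = c⁻¹ * torusIntegral (fun ζ => (∏ i, (ζ i - z i))⁻¹ * f ζ) 0 (fun _ => r) := by
    rw [cauchy_formula h0 h1 hf hz, inv_mul_cancel_left₀ hc0]
  rw [hfz]
  simp only [mul_assoc]
  refine HasSum.mul_left _ ?_
  simp only [mul_comm _ (mpow z _), ← torusIntegral_const_mul]
  unfold torusIntegral
  have hfc := continuous_comp_torus h0 h1 hf
  have hne : ∀ (θ : Fin d → ℝ) i, torusMap 0 (fun _ => r) θ i ≠ 0 := fun θ i => by
    rw [← norm_pos_iff, norm_torusMap h0]; exact h0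
  have hgeo : Summable (fun α : Fin d → ℕ => ∏ i, (‖z i‖ / r) ^ α i) :=
    summable_geometric _ (fun i => by positivity) (fun i => (div_lt_one h0).2 (hz i))
  have hexp : Continuous fun θ : Fin d → ℝ =>
      (∏ i, (r : ℂ) * Complex.exp (θ i * Complex.I) * Complex.I) := by fun_prop
  refine MeasureTheory.hasSum_integral_of_dominated_convergence
    (fun α θ => (∏ i, (‖z i‖ / r) ^ α i) * ‖f (torusMap 0 (fun _ => r) θ)‖) ?_ ?_ ?_ ?_ ?_
  · intro α
    refine Continuous.aestronglyMeasurable ?_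
    refine hexp.smul (continuous_const.mul (Continuous.mul ?_ hfc))
    refine Continuous.inv₀ ?_ fun θ => Finset.prod_ne_zero_iff.2 fun i _ => pow_ne_zero _ (hne θ i)
    exact continuous_finsetProd _ fun i _ =>
      ((continuous_apply i).comp (continuous_torus r)).pow _
  · refine fun α => Filter.Eventually.of_forall fun θ => le_of_eq ?_
    rw [norm_smul, norm_mul, norm_mul, norm_inv, norm_prod, norm_prod, ← mul_assoc, ← mul_assoc]
    congr 1
    simp only [norm_mul, norm_pow, norm_torusMap h0, Complex.norm_exp_ofReal_mul_I,
      Complex.norm_I, Complex.norm_real, Real.norm_of_nonneg h0.le, mul_one, mpow, norm_prod]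
    rw [← Finset.prod_inv_distrib, ← Finset.prod_mul_distrib, ← Finset.prod_mul_distrib]
    refine Finset.prod_congr rfl fun i _ => ?_
    rw [div_pow, pow_succ]
    field_simp
  · exact Filter.Eventually.of_forall fun θ => hgeo.mul_right _
  · simp only [tsum_mul_right]
    exact (continuous_const.mul hfc.norm).integrableOn_Icc
  · refine Filter.Eventually.of_forall fun θ => ?_
    refine HasSum.const_smul _ ?_
    simp only [← mul_assoc]
    refine HasSum.mul_right _ ?_
    have h := (hasSum_geometric (fun i => z i / torusMap 0 (fun _ => r) θ i) (fun i => by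
      rw [norm_div, norm_torusMap h0]; exact (div_lt_one h0).2 (hz i))).mul_left
        (∏ i, (torusMap 0 (fun _ => r) θ i))⁻¹
    convert h using 2 with α
    · simp only [mpow, div_pow, Finset.prod_div_distrib, pow_succ, Finset.prod_mul_distrib]
      rw [mul_inv, div_eq_mul_inv]; ring
    · rw [← Finset.prod_inv_distrib, ← Finset.prod_inv_distrib, ← Finset.prod_mul_distrib]
      refine Finset.prod_congr rfl fun i _ => ?_
      have h2 := sub_ne_zero_torus h0 hz θ i
      have h3 := hne θ i
      rw [← mul_inv, mul_sub, mul_one, mul_div_cancel₀ _ h3]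

/-- A holomorphic function on the polydisc is the sum of a power series there. -/
theorem exists_hasSum {d : ℕ} {f : (Fin d → ℂ) → ℂ} (hf : DifferentiableOn ℂ f (polydisc d)) :
    ∃ a : (Fin d → ℕ) → ℂ, ∀ z ∈ polydisc d, HasSum (fun α => a α * mpow z α) (f z) := by
  obtain ⟨a, ha⟩ := exists_hasSum_of_lt (r := 1 / 2) (by norm_num) (by norm_num) hf
  refine ⟨a, fun z hz => ?_⟩
  obtain ⟨s, hs1, hs⟩ : ∃ s : ℝ, s < 1 ∧ ∀ i, ‖z i‖ < s := by
    obtain ⟨s, hs, hs1⟩ := exists_between ((pi_norm_lt_iff (x := z) one_pos).2 hz)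
    exact ⟨s, hs1, fun i => (norm_le_pi_norm z i).trans_lt hs⟩
  obtain ⟨b, hb⟩ := exists_hasSum_of_lt (r := max s (1 / 2)) (by positivity)
    (max_lt hs1 (by norm_num)) hf
  have hab : a - b = 0 := by
    refine coeff_eq_zero (ρ := 1 / 2) (by norm_num) _ fun w hw => ?_
    have := (ha w hw).sub (hb w fun i => (hw i).trans_le (le_max_right _ _))
    simpa [sub_mul] using this
  rw [sub_eq_zero.1 hab]
  exact hb z fun i => (hs i).trans_le (le_max_left _ _)

/-- Holomorphic functions on the polydisc. -/
def IsHolomorphic {d : ℕ} (f : polydisc d → ℂ) : Prop :=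
  ∃ F : (Fin d → ℂ) → ℂ, DifferentiableOn ℂ F (polydisc d) ∧ ∀ z : polydisc d, F z = f z

/-- The family `a` is the family of coefficients of the power series of `f` at `0`. -/
def IsPowerSeries {d : ℕ} (a : (Fin d → ℕ) → ℂ) (f : polydisc d → ℂ) : Prop :=
  ∀ z : polydisc d, HasSum (fun α => a α * mpow (z : Fin d → ℂ) α) (f z)

open Classical in
/-- The power series coefficients at `0` of a holomorphic function on the polydisc; they exist
and are unique. -/
def coeff {d : ℕ} (f : polydisc d → ℂ) : (Fin d → ℕ) → ℂ :=
  if h : ∃ a, IsPowerSeries a f then h.choose else 0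

theorem IsPowerSeries.coeff_eq {d : ℕ} {a : (Fin d → ℕ) → ℂ} {f : polydisc d → ℂ}
    (h : IsPowerSeries a f) : coeff f = a := by
  have hex : ∃ a, IsPowerSeries a f := ⟨a, h⟩
  rw [coeff, dif_pos hex]
  refine sub_eq_zero.1 (coeff_eq_zero one_pos _ fun z hz => ?_)
  simpa [sub_mul] using (hex.choose_spec ⟨z, hz⟩).sub (h ⟨z, hz⟩)

theorem IsHolomorphic.isPowerSeries {d : ℕ} {f : polydisc d → ℂ} (hf : IsHolomorphic f) :
    IsPowerSeries (coeff f) f := by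
  obtain ⟨F, hF, hFf⟩ := hf
  obtain ⟨a, ha⟩ := exists_hasSum hF
  have h : IsPowerSeries a f := fun z => hFf z ▸ ha z z.2
  rwa [h.coeff_eq]

/-- The product `T ^ α` of the powers of a commuting tuple of operators. -/
def opPow {d : ℕ} {E : Type} [NormedAddCommGroup E] [InnerProductSpace ℂ E]
    (T : Fin d → E →L[ℂ] E) (α : Fin d → ℕ) : E →L[ℂ] E :=
  (List.ofFn fun i => T i ^ α i).prod

/-- The operator `f(T)`, obtained by inserting `T` in the power series of `f`. -/
def opEval {d : ℕ} {E : Type} [NormedAddCommGroup E] [InnerProductSpace ℂ E]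
    (f : polydisc d → ℂ) (T : Fin d → E →L[ℂ] E) : E →L[ℂ] E :=
  ∑' α, coeff f α • opPow T α

/-- The Schur--Agler norm, with values in `[0, ∞]`: the supremum of `‖f(T)‖` over all commuting
tuples `T` of strict contractions on a complex Hilbert space. -/
def saNorm {d : ℕ} (f : polydisc d → ℂ) : ENNReal :=
  ⨆ (E : Type) (_ : NormedAddCommGroup E) (_ : InnerProductSpace ℂ E) (_ : CompleteSpace E)
    (T : Fin d → E →L[ℂ] E) (_ : ∀ i j, Commute (T i) (T j)) (_ : ∀ i, ‖T i‖ < 1),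
    ‖opEval f T‖ₑ

theorem enorm_opEval_le {d : ℕ} (f : polydisc d → ℂ) {E : Type} [N : NormedAddCommGroup E]
    [I : InnerProductSpace ℂ E] [C : CompleteSpace E] (T : Fin d → E →L[ℂ] E)
    (hT : ∀ i j, Commute (T i) (T j)) (hT' : ∀ i, ‖T i‖ < 1) : ‖opEval f T‖ₑ ≤ saNorm f :=
  le_iSup_of_le E <| le_iSup_of_le N <| le_iSup_of_le I <| le_iSup_of_le C <|
    le_iSup_of_le T <| le_iSup_of_le hT <| le_iSup_of_le hT' le_rfl

theorem norm_opPow_le {d : ℕ} {E : Type} [NormedAddCommGroup E] [InnerProductSpace ℂ E]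
    (T : Fin d → E →L[ℂ] E) (α : Fin d → ℕ) : ‖opPow T α‖ ≤ ∏ i, ‖T i‖ ^ α i := by
  have hpow : ∀ (S : E →L[ℂ] E) (n : ℕ), ‖S ^ n‖ ≤ ‖S‖ ^ n := by
    intro S n
    induction n with
    | zero => exact ContinuousLinearMap.norm_id_le
    | succ k ih =>
      rw [pow_succ, pow_succ]
      exact (norm_mul_le _ _).trans (by gcongr)
  have hlist : ∀ l : List (E →L[ℂ] E), ‖l.prod‖ ≤ (l.map fun S => ‖S‖).prod := by
    intro l
    induction l with
    | nil => exact ContinuousLinearMap.norm_id_le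
    | cons S l ih =>
      simp only [List.prod_cons, List.map_cons]
      exact (norm_mul_le _ _).trans (by gcongr)
  refine (hlist _).trans ?_
  rw [List.map_ofFn, List.prod_ofFn]
  exact Finset.prod_le_prod (fun i _ => norm_nonneg _) fun i _ => hpow _ _

theorem summable_opEval {d : ℕ} {E : Type} [NormedAddCommGroup E] [InnerProductSpace ℂ E]
    [CompleteSpace E] {f : polydisc d → ℂ} (hf : IsHolomorphic f) (T : Fin d → E →L[ℂ] E)
    (hT : ∀ i, ‖T i‖ < 1) : Summable fun α => coeff f α • opPow T α := by
  have h := (hf.isPowerSeries ⟨fun i => (‖T i‖ : ℂ), fun i => by simpa using hT i⟩).summable.norm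
  refine Summable.of_norm_bounded h fun α => ?_
  rw [norm_smul, norm_mul]
  refine mul_le_mul_of_nonneg_left ((norm_opPow_le T α).trans (le_of_eq ?_)) (norm_nonneg _)
  simp [mpow]

/-- The Schur--Agler space. -/
def SA (d : ℕ) : Submodule ℂ (polydisc d → ℂ) where
  carrier := {f | IsHolomorphic f ∧ saNorm f < ⊤}
  zero_mem' := by
    have h0 : coeff (0 : polydisc d → ℂ) = 0 :=
      IsPowerSeries.coeff_eq fun z => by simp [hasSum_zero]
    refine ⟨⟨0, differentiableOn_const 0, fun _ => rfl⟩, ?_⟩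
    simp [saNorm, opEval, h0]
  add_mem' := by
    rintro f g ⟨hf, hf'⟩ ⟨hg, hg'⟩
    have hc : coeff (f + g) = coeff f + coeff g := IsPowerSeries.coeff_eq fun z => by
      simpa [add_mul] using (hf.isPowerSeries z).add (hg.isPowerSeries z)
    refine ⟨?_, ?_⟩
    · obtain ⟨F, hF, hFf⟩ := hf
      obtain ⟨G, hG, hGg⟩ := hg
      exact ⟨F + G, hF.add hG, fun z => by simp [hFf, hGg]⟩
    · refine lt_of_le_of_lt ?_ (ENNReal.add_lt_top.2 ⟨hf', hg'⟩)
      refine iSup_le fun E => iSup_le fun _ => iSup_le fun _ => iSup_le fun _ =>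
        iSup_le fun T => iSup_le fun hT => iSup_le fun hT' => ?_
      have hs : opEval (f + g) T = opEval f T + opEval g T := by
        rw [opEval, opEval, opEval, ← (summable_opEval hf T hT').tsum_add
          (summable_opEval hg T hT')]
        simp [hc, add_smul]
      rw [hs]
      exact (enorm_add_le _ _).trans
        (add_le_add (enorm_opEval_le f T hT hT') (enorm_opEval_le g T hT hT'))
  smul_mem' := by
    rintro c f ⟨hf, hf'⟩
    have hc : coeff (c • f) = c • coeff f := IsPowerSeries.coeff_eq fun z => by
      simpa [mul_assoc] using (hf.isPowerSeries z).mul_left c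
    refine ⟨?_, ?_⟩
    · obtain ⟨F, hF, hFf⟩ := hf
      exact ⟨c • F, hF.const_smul c, fun z => by simp [hFf]⟩
    · refine lt_of_le_of_lt ?_ (ENNReal.mul_lt_top (enorm_lt_top (x := c)) hf')
      refine iSup_le fun E => iSup_le fun _ => iSup_le fun _ => iSup_le fun _ =>
        iSup_le fun T => iSup_le fun hT => iSup_le fun hT' => ?_
      have hs : opEval (c • f) T = c • opEval f T := by
        rw [opEval, opEval, ← (summable_opEval hf T hT').tsum_const_smul c]
        simp [hc, mul_smul]
      rw [hs, enorm_smul]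
      exact mul_le_mul_right (enorm_opEval_le f T hT hT') _

/-- The Schur--Agler space carries the Schur--Agler norm. -/
instance instNormSA (d : ℕ) : Norm (SA d) := ⟨fun f => (saNorm (f : polydisc d → ℂ)).toReal⟩

/-- The Hardy space of the polydisc: a function `∑ a_α z ^ α` with square summable coefficients
is represented by the family `(a_α)`, see `toFun` for the function itself. -/
abbrev H2 (d : ℕ) : Type := lp (fun _ : Fin d → ℕ => ℂ) 2

theorem H2.summable_mpow {d : ℕ} (h : H2 d) (z : polydisc d) :
    Summable (fun α => h α * mpow (z : Fin d → ℂ) α) := by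
  refine Summable.of_norm_bounded
    ((summable_geometric (fun i => ‖(z : Fin d → ℂ) i‖) (fun i => norm_nonneg _) z.2).mul_left ‖h‖)
    fun α => ?_
  rw [norm_mul]
  refine mul_le_mul (lp.norm_apply_le_norm two_ne_zero h α) (le_of_eq ?_) (norm_nonneg _)
    (norm_nonneg _)
  simp [mpow]

/-- The function `z ↦ ∑ a_α z ^ α` on the polydisc. -/
def toFun {d : ℕ} : H2 d →ₗ[ℂ] (polydisc d → ℂ) where
  toFun h z := ∑' α, h α * mpow (z : Fin d → ℂ) α
  map_add' g h := by
    funext z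
    simp only [lp.coeFn_add, Pi.add_apply, add_mul]
    exact (H2.summable_mpow g z).tsum_add (H2.summable_mpow h z)
  map_smul' c h := by
    funext z
    simp only [lp.coeFn_smul, Pi.smul_apply, smul_eq_mul, mul_assoc, RingHom.id_apply]
    exact tsum_mul_left

/-- The monomial `z ^ α`. -/
def mono {d : ℕ} (α : Fin d → ℕ) : H2 d := lp.single 2 α 1

/-- The constant function `1`. -/
abbrev one (d : ℕ) : H2 d := mono 0

/-- The family of coefficients of `z_i h(z)`. -/
def shift {d : ℕ} (i : Fin d) (h : (Fin d → ℕ) → ℂ) (α : Fin d → ℕ) : ℂ :=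
  if α i = 0 then 0 else h (Function.update α i (α i - 1))

theorem shift_injective {d : ℕ} (i : Fin d) :
    Function.Injective (fun α : Fin d → ℕ => Function.update α i (α i + 1)) := by
  intro α β hab
  funext j
  have hj := congrFun hab j
  by_cases hji : j = i
  · subst hji; simpa using hj
  · simpa [Function.update_of_ne hji] using hj

theorem shift_eq_zero {d : ℕ} (i : Fin d) (h : (Fin d → ℕ) → ℂ) (α : Fin d → ℕ)
    (hα : α ∉ Set.range (fun α : Fin d → ℕ => Function.update α i (α i + 1))) :
    shift i h α = 0 := by
  have h0 : α i = 0 := by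
    by_contra h0
    refine hα ⟨Function.update α i (α i - 1), ?_⟩
    have : α i - 1 + 1 = α i := by omega
    simp [this]
  simp [shift, h0]

theorem shift_hasSum {d : ℕ} (i : Fin d) (h : (Fin d → ℕ) → ℂ) {s : ℝ}
    (hs : HasSum (fun α => ‖h α‖ ^ (2 : ENNReal).toReal) s) :
    HasSum (fun α => ‖shift i h α‖ ^ (2 : ENNReal).toReal) s := by
  rw [← (shift_injective i).hasSum_iff]
  · simpa [Function.comp_def, shift] using hs
  · intro α hα
    simp [shift_eq_zero i h α hα]

/-- The multiplication operator `M_{z_i}` on the Hardy space. -/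
def Mz {d : ℕ} (i : Fin d) : H2 d →L[ℂ] H2 d :=
  LinearIsometry.toContinuousLinearMap
    { toFun := fun h => ⟨shift i h, memℓp_gen (shift_hasSum i h
        (lp.hasSum_norm (by norm_num) h)).summable⟩
      map_add' := fun g h => by
        ext α
        simp only [shift, lp.coeFn_add, Pi.add_apply]
        split_ifs <;> simp
      map_smul' := fun c h => by
        ext α
        simp only [shift, lp.coeFn_smul, Pi.smul_apply, RingHom.id_apply]
        split_ifs <;> simp
      norm_map' := fun h => by
        have h1 := shift_hasSum i h (lp.hasSum_norm (by norm_num) h)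
        have h2 := lp.hasSum_norm (p := 2) (by norm_num) (⟨shift i h, memℓp_gen h1.summable⟩ : H2 d)
        have h3 := h2.unique h1
        exact (Real.rpow_left_inj (norm_nonneg _) (norm_nonneg _) (by norm_num)).1 h3 }

theorem Mz_apply {d : ℕ} (i : Fin d) (h : H2 d) (α : Fin d → ℕ) :
    Mz i h α = shift i h α := rfl

theorem toFun_Mz {d : ℕ} (i : Fin d) (h : H2 d) (z : polydisc d) :
    toFun (Mz i h) z = (z : Fin d → ℂ) i * toFun h z := by
  change ∑' α, shift i h α * mpow (z : Fin d → ℂ) α =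
    (z : Fin d → ℂ) i * ∑' α, h α * mpow (z : Fin d → ℂ) α
  rw [← tsum_mul_left, ← (shift_injective i).tsum_eq]
  · refine tsum_congr fun α => ?_
    have h1 : mpow (z : Fin d → ℂ) (Function.update α i (α i + 1)) =
        (z : Fin d → ℂ) i * mpow (z : Fin d → ℂ) α := by
      unfold mpow
      rw [← Finset.mul_prod_erase _ _ (Finset.mem_univ i),
        ← Finset.mul_prod_erase _ (fun j => (z : Fin d → ℂ) j ^ α j) (Finset.mem_univ i),
        Function.update_self, pow_succ', mul_assoc]
      congr 2
      refine Finset.prod_congr rfl fun j hj => ?_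
      rw [Function.update_of_ne (Finset.ne_of_mem_erase hj)]
    rw [h1]
    simp [shift]
    ring
  · intro α hα
    by_contra h0
    exact hα (by simp [shift_eq_zero i h α h0])

/-- The cone `𝓛_c`; the order is the order of self-adjoint operators. -/
def Lc (d : ℕ) : Set (H2 d →L[ℂ] H2 d) :=
  {L | 0 ≤ L ∧ ∀ i, (Mz i).adjoint ∘L L ∘L Mz i ≤ L}

/-- The operator `g ⊗ g`, that is `h ↦ ⟨h, g⟩ g`. -/
def tensorSelf {d : ℕ} (g : H2 d) : H2 d →L[ℂ] H2 d := InnerProductSpace.rankOne ℂ g g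

/-- The set `𝓛_c(g)` of all `L` in `𝓛_c` with `L ≥ g ⊗ g`. -/
def LcAbove {d : ℕ} (g : H2 d) : Set (H2 d →L[ℂ] H2 d) := {L | L ∈ Lc d ∧ tensorSelf g ≤ L}

/-- The quantity `⟨L 1, 1⟩ ^ (1/2)`. -/
def gauge {d : ℕ} (L : H2 d →L[ℂ] H2 d) : ℝ := √(inner ℂ (one d) (L (one d))).re

/-- The dual Schur--Agler norm `‖g‖_*`. -/
def dualSANorm {d : ℕ} (g : H2 d) : ℝ := sInf (gauge '' LcAbove g)

/-- The space `P_n` of homogeneous polynomials of degree `n`. -/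
def P (d n : ℕ) : Submodule ℂ (H2 d) := Submodule.span ℂ (mono '' {α | ∑ i, α i = n})

instance instFiniteDimensionalP (d n : ℕ) : FiniteDimensional ℂ (P d n) := by
  refine FiniteDimensional.span_of_finite ℂ (Set.Finite.image _ ?_)
  refine (Set.finite_Iic (fun _ : Fin d => n)).subset fun α hα i => ?_
  rw [← (show ∑ i, α i = n from hα)]
  exact Finset.single_le_sum (fun j _ => Nat.zero_le (α j)) (Finset.mem_univ i)

/-- An operator on `P_k`, extended by zero on the orthogonal complement of `P_k`. -/
def extend {d : ℕ} (k : ℕ) (A : P d k →L[ℂ] P d k) : H2 d →L[ℂ] H2 d :=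
  (P d k).subtypeL ∘L A ∘L (P d k).orthogonalProjectionOnto

/-- The graded cone `𝓛_c^{(n)}`: all `L` in `𝓛_c` of the form `L_0 + ... + L_n`, where `L_k` is an
operator on `P_k`. -/
def LcGraded (d n : ℕ) : Set (H2 d →L[ℂ] H2 d) :=
  {L | L ∈ Lc d ∧ ∃ A : ∀ k, P d k →L[ℂ] P d k,
    L = ∑ k ∈ Finset.range (n + 1), extend k (A k)}

/-- The graded cone `𝓛_c^{(n)}(q)`: all `L = L_0 + ... + L_n` in `𝓛_c^{(n)}` with `L ≥ q ⊗ q` and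
`L_n = q ⊗ q`. -/
def LcGradedAbove {d : ℕ} (n : ℕ) (q : H2 d) : Set (H2 d →L[ℂ] H2 d) :=
  {L | L ∈ LcAbove q ∧ ∃ A : ∀ k, P d k →L[ℂ] P d k,
    L = ∑ k ∈ Finset.range (n + 1), extend k (A k) ∧ extend n (A n) = tensorSelf q}

/-- The vector space `H²`, to be normed by the dual Schur--Agler norm. -/
def H2Star (d : ℕ) : Type := H2 d

instance instAddCommGroupH2Star (d : ℕ) : AddCommGroup (H2Star d) := inferInstanceAs (AddCommGroup (H2 d))

instance instModuleH2Star (d : ℕ) : Module ℂ (H2Star d) := inferInstanceAs (Module ℂ (H2 d))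

/-- The identity map of `H²`. -/
def toStar {d : ℕ} : H2 d ≃ₗ[ℂ] H2Star d := LinearEquiv.refl ℂ (H2 d)

instance instNormH2Star (d : ℕ) : Norm (H2Star d) := ⟨fun g => dualSANorm (toStar.symm g)⟩

/-- The space `P_n` as a subspace of `(H², ‖·‖_*)`. -/
def PStar (d n : ℕ) : Submodule ℂ (H2Star d) := (P d n).map toStar.toLinearMap

/-- The space `P_n` as a subspace of the Schur--Agler space. -/
def PSA (d n : ℕ) : Submodule ℂ (SA d) := ((P d n).map toFun).comap (SA d).subtype

end

end SchurAgler

/-! Everything rests on one equivalence, `saNorm_toFun_le_iff`: for real `S ≥ 0`, `‖f‖_SA ≤ S` holds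
exactly when `|⟨f, g⟩| ≤ S ‖g‖_*` for all `g` in `H²`.

From right to left (`saNorm_toFun_le`): a commuting tuple `T` of strict contractions and a vector
`x` give the orbit map `V h = h(T) x`, and `V* V` lies in the cone because multiplication by `z_i`
becomes application of `T_i`. Hence `‖V* y‖_* ≤ ‖y‖ ‖x‖`, and `y = f(T) x` yields `‖f(T) x‖² = ⟨f,
V* y⟩ ≤ S ‖f(T) x‖ ‖x‖`.

From left to right (`norm_inner_le_mul_gauge`): this is a GNS construction. An `L` in `𝓛_c(g)`
defines a semi-inner product in which the `M_{z_i}` become commuting contractions `T_i` and `⟨·, g⟩`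
becomes a functional `φ` of norm at most one. Up to a dilation `r → 1`, `⟨f, g⟩ = φ(f(T)[1])`, which
is at most `S ‖[1]‖ = S ⟨L1, 1⟩^(1/2)`.

Evaluating `f` at `r M_z` and applying the result to `1` puts the Schur--Agler space inside `H²`. A
functional bounded for `‖·‖_*` is bounded for `‖·‖_2`, so the Riesz theorem represents it, and the
equivalence places the representing function in the Schur--Agler space.

For homogeneous `q` of degree `n`, any competitor `L` may be replaced by its diagonal blocks in
degrees below `n` plus `q ⊗ q` in degree `n` (`truncate`). This stays admissible and does not
increase `⟨L1, 1⟩`; it also makes the projection onto `P_n` contractive for `‖·‖_*`. -/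

namespace SchurAgler

open Filter Topology

/-! ### The operator order through quadratic forms -/

section Order

variable {H : Type*} [NormedAddCommGroup H] [InnerProductSpace ℂ H]

theorem re_inner_le_of_le {A B : H →L[ℂ] H} (hAB : A ≤ B) (x : H) :
    (inner ℂ x (A x)).re ≤ (inner ℂ x (B x)).re := by
  have h := ((ContinuousLinearMap.le_def A B).1 hAB).re_inner_nonneg_right x
  simpa [inner_sub_right] using h

variable [CompleteSpace H]

/-- Self-adjointness is essential: the real part of the form does not see the skew-adjoint part of
an operator. -/
theorem le_of_re_inner_le {A B : H →L[ℂ] H} (hA : IsSelfAdjoint A) (hB : IsSelfAdjoint B)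
    (h : ∀ x, (inner ℂ x (A x)).re ≤ (inner ℂ x (B x)).re) : A ≤ B := by
  rw [ContinuousLinearMap.le_def, ContinuousLinearMap.isPositive_def']
  refine ⟨hB.sub hA, fun x => ?_⟩
  rw [ContinuousLinearMap.reApplyInnerSelf_apply, ← inner_re_symm]
  simpa [inner_sub_right] using h x

theorem isSelfAdjoint_of_nonneg {A : H →L[ℂ] H} (hA : 0 ≤ A) : IsSelfAdjoint A :=
  ((ContinuousLinearMap.nonneg_iff_isPositive A).1 hA).isSelfAdjoint

end Order

variable {d : ℕ}

theorem isSelfAdjoint_tensorSelf (g : H2 d) : IsSelfAdjoint (tensorSelf g) :=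
  (InnerProductSpace.isPositive_rankOne_self g).isSelfAdjoint

theorem re_inner_tensorSelf (g h : H2 d) :
    (inner ℂ h (tensorSelf g h)).re = ‖inner ℂ g h‖ ^ 2 := by
  rw [tensorSelf, InnerProductSpace.rankOne_apply, inner_smul_right, ← inner_conj_symm h g,
    Complex.mul_conj, Complex.ofReal_re, Complex.normSq_eq_norm_sq]

/-- Positivity of `L` is absent from the right side because it follows from `L ≥ g ⊗ g`. Later
membership proofs reduce to these scalar inequalities. -/
theorem mem_LcAbove_iff {g : H2 d} {L : H2 d →L[ℂ] H2 d} :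
    L ∈ LcAbove g ↔ IsSelfAdjoint L ∧
      (∀ i h, (inner ℂ (Mz i h) (L (Mz i h))).re ≤ (inner ℂ h (L h)).re) ∧
      ∀ h, ‖inner ℂ g h‖ ^ 2 ≤ (inner ℂ h (L h)).re := by
  constructor
  · rintro ⟨⟨h0, hM⟩, hg⟩
    refine ⟨isSelfAdjoint_of_nonneg h0, fun i h => ?_, fun h => ?_⟩
    · have := re_inner_le_of_le (hM i) h
      simpa [ContinuousLinearMap.adjoint_inner_right] using this
    · rw [← re_inner_tensorSelf]
      exact re_inner_le_of_le hg h
  · rintro ⟨hL, hM, hg⟩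
    refine ⟨⟨le_of_re_inner_le (IsSelfAdjoint.zero _) hL fun h => ?_, fun i =>
      le_of_re_inner_le ?_ hL fun h => ?_⟩,
      le_of_re_inner_le (isSelfAdjoint_tensorSelf g) hL fun h => ?_⟩
    · simpa using (sq_nonneg _).trans (hg h)
    · exact hL.adjoint_conj (Mz i)
    · simpa [ContinuousLinearMap.adjoint_inner_right] using hM i h
    · rw [re_inner_tensorSelf]
      exact hg h

theorem gauge_nonneg (L : H2 d →L[ℂ] H2 d) : 0 ≤ gauge L := Real.sqrt_nonneg _

theorem gauge_sq {g : H2 d} {L : H2 d →L[ℂ] H2 d} (hL : L ∈ LcAbove g) :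
    gauge L ^ 2 = (inner ℂ (one d) (L (one d))).re :=
  Real.sq_sqrt ((sq_nonneg _).trans ((mem_LcAbove_iff.1 hL).2.2 _))

/-! ### Monomials and coefficient bounds -/

theorem mono_apply (α β : Fin d → ℕ) : mono α β = if β = α then (1 : ℂ) else 0 := by
  simp [mono, lp.single_apply, Pi.single_apply]

theorem inner_mono_left (α : Fin d → ℕ) (h : H2 d) : inner ℂ (mono α) h = h α := by
  simp [mono, lp.inner_single_left]

theorem inner_mono_right (α : Fin d → ℕ) (h : H2 d) :
    inner ℂ h (mono α) = starRingEnd ℂ (h α) := by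
  simp [mono, lp.inner_single_right]

theorem norm_mono (α : Fin d → ℕ) : ‖mono α‖ = 1 := by
  simp [mono, lp.norm_single]

theorem Mz_mono (i : Fin d) (α : Fin d → ℕ) :
    Mz i (mono α) = mono (Function.update α i (α i + 1)) := by
  ext β
  rw [Mz_apply, mono_apply, shift]
  split_ifs with h1 h2 h2
  · subst h2; simp at h1
  · rfl
  · subst h2; simp [mono_apply]
  · rw [mono_apply, if_neg]
    rintro rfl
    refine h2 ?_
    have : β i - 1 + 1 = β i := by omega
    simp [this]

theorem multiIndex_induction {p : (Fin d → ℕ) → Prop} (h0 : p 0)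
    (hs : ∀ α i, p α → p (Function.update α i (α i + 1))) (α : Fin d → ℕ) : p α := by
  induction hn : ∑ i, α i generalizing α with
  | zero =>
    have : α = 0 := by
      funext i
      simpa using (Finset.sum_eq_zero_iff.1 hn) i (Finset.mem_univ i)
    exact this ▸ h0
  | succ n ih =>
    obtain ⟨i, hi⟩ : ∃ i, α i ≠ 0 := by
      by_contra! h
      simp [h] at hn
    have hα : α = Function.update (Function.update α i (α i - 1)) i
        (Function.update α i (α i - 1) i + 1) := by
      have : α i - 1 + 1 = α i := by omega
      simp [this]
    rw [hα]
    refine hs _ _ (ih _ ?_)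
    rw [Finset.sum_update_of_mem (Finset.mem_univ i), ← Finset.erase_eq]
    rw [← Finset.add_sum_erase _ _ (Finset.mem_univ i)] at hn
    omega

/-- Each multiplication by a coordinate can only decrease the form of `L`, and every monomial arises
from `1` in this way. -/
theorem re_inner_mono_le {g : H2 d} {L : H2 d →L[ℂ] H2 d} (hL : L ∈ LcAbove g)
    (α : Fin d → ℕ) :
    (inner ℂ (mono α) (L (mono α))).re ≤ (inner ℂ (one d) (L (one d))).re := by
  induction α using multiIndex_induction with
  | h0 => exact le_rfl
  | hs α i ih =>
    rw [← Mz_mono]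
    exact ((mem_LcAbove_iff.1 hL).2.1 i _).trans ih

/-- The inequality `L ≥ g ⊗ g` is tested on `z ^ α`. This is what makes the dual norm definite. -/
theorem norm_apply_le_gauge {g : H2 d} {L : H2 d →L[ℂ] H2 d} (hL : L ∈ LcAbove g)
    (α : Fin d → ℕ) : ‖g α‖ ≤ gauge L := by
  refine le_of_sq_le_sq ?_ (gauge_nonneg L)
  rw [gauge_sq hL]
  refine le_trans ?_ (re_inner_mono_le hL α)
  simpa [inner_mono_right] using (mem_LcAbove_iff.1 hL).2.2 (mono α)

/-! ### The dual Schur--Agler norm is a norm -/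

theorem norm_Mz (i : Fin d) (h : H2 d) : ‖Mz i h‖ = ‖h‖ := by
  unfold Mz
  rw [LinearIsometry.coe_toContinuousLinearMap]
  exact LinearIsometry.norm_map _ h

theorem re_inner_real_smul (c : ℝ) (L : H2 d →L[ℂ] H2 d) (h : H2 d) :
    (inner ℂ h (((c : ℂ) • L) h)).re = c * (inner ℂ h (L h)).re := by
  rw [smul_apply, inner_smul_right, Complex.re_ofReal_mul]

theorem re_inner_one (h : H2 d) :
    (inner ℂ h ((1 : H2 d →L[ℂ] H2 d) h)).re = ‖h‖ ^ 2 := by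
  rw [one_apply_eq_self]
  exact inner_self_eq_norm_sq (𝕜 := ℂ) h

theorem isSelfAdjoint_real_smul (c : ℝ) {L : H2 d →L[ℂ] H2 d} (hL : IsSelfAdjoint L) :
    IsSelfAdjoint ((c : ℂ) • L) := IsSelfAdjoint.smul (by simp [IsSelfAdjoint]) hL

/-- Cauchy--Schwarz, together with the `M_{z_i}` being isometries. It keeps the infimum from being
taken over the empty set and gives `‖g‖_* ≤ ‖g‖_2`. -/
theorem smul_one_mem_LcAbove (g : H2 d) :
    ((‖g‖ ^ 2 : ℝ) : ℂ) • (1 : H2 d →L[ℂ] H2 d) ∈ LcAbove g := by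
  refine mem_LcAbove_iff.2 ⟨isSelfAdjoint_real_smul _ (IsSelfAdjoint.one _), fun i h => ?_,
    fun h => ?_⟩
  · rw [re_inner_real_smul, re_inner_real_smul, re_inner_one, re_inner_one, norm_Mz]
  · rw [re_inner_real_smul, re_inner_one, ← mul_pow]
    exact pow_le_pow_left₀ (norm_nonneg _) (norm_inner_le_norm g h) 2

theorem bddBelow_gauge (s : Set (H2 d →L[ℂ] H2 d)) : BddBelow (gauge '' s) :=
  ⟨0, by rintro _ ⟨L, -, rfl⟩; exact gauge_nonneg L⟩

theorem nonempty_gauge (g : H2 d) : (gauge '' LcAbove g).Nonempty :=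
  ⟨_, _, smul_one_mem_LcAbove g, rfl⟩

theorem dualSANorm_nonneg (g : H2 d) : 0 ≤ dualSANorm g :=
  Real.sInf_nonneg (by rintro _ ⟨L, -, rfl⟩; exact gauge_nonneg L)

theorem dualSANorm_le_gauge {g : H2 d} {L : H2 d →L[ℂ] H2 d} (hL : L ∈ LcAbove g) :
    dualSANorm g ≤ gauge L := csInf_le (bddBelow_gauge _) ⟨L, hL, rfl⟩

theorem le_dualSANorm {g : H2 d} {c : ℝ} (h : ∀ L ∈ LcAbove g, c ≤ gauge L) :
    c ≤ dualSANorm g :=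
  le_csInf (nonempty_gauge g) (by rintro _ ⟨L, hL, rfl⟩; exact h L hL)

theorem exists_gauge_lt {g : H2 d} {c : ℝ} (h : dualSANorm g < c) :
    ∃ L ∈ LcAbove g, gauge L < c := by
  obtain ⟨_, ⟨L, hL, rfl⟩, h⟩ := exists_lt_of_csInf_lt (nonempty_gauge g) h
  exact ⟨L, hL, h⟩

theorem dualSANorm_le_of_sq {g : H2 d} {L : H2 d →L[ℂ] H2 d} (hL : L ∈ LcAbove g) {c : ℝ}
    (hc : 0 ≤ c) (h : (inner ℂ (one d) (L (one d))).re ≤ c ^ 2) : dualSANorm g ≤ c :=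
  (dualSANorm_le_gauge hL).trans (le_of_sq_le_sq (gauge_sq hL ▸ h) hc)

theorem dualSANorm_le_norm (g : H2 d) : dualSANorm g ≤ ‖g‖ := by
  refine dualSANorm_le_of_sq (smul_one_mem_LcAbove g) (norm_nonneg g) (le_of_eq ?_)
  rw [re_inner_real_smul, re_inner_one, norm_mono, one_pow, mul_one]

theorem norm_apply_le_dualSANorm (g : H2 d) (α : Fin d → ℕ) : ‖g α‖ ≤ dualSANorm g :=
  le_dualSANorm fun _ hL => norm_apply_le_gauge hL α

theorem dualSANorm_smul_le (c : ℂ) (g : H2 d) : dualSANorm (c • g) ≤ ‖c‖ * dualSANorm g := by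
  rcases eq_or_ne c 0 with rfl | hc
  · simpa using dualSANorm_le_norm (0 : H2 d)
  have hc' : 0 < ‖c‖ := norm_pos_iff.2 hc
  rw [← div_le_iff₀' hc']
  refine le_dualSANorm fun L hL => ?_
  rw [div_le_iff₀' hc']
  obtain ⟨h1, h2, h3⟩ := mem_LcAbove_iff.1 hL
  refine dualSANorm_le_of_sq (L := ((‖c‖ ^ 2 : ℝ) : ℂ) • L)
    (mem_LcAbove_iff.2 ⟨isSelfAdjoint_real_smul _ h1, fun i h => ?_, fun h => ?_⟩)
    (mul_nonneg hc'.le (gauge_nonneg L)) ?_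
  · rw [re_inner_real_smul, re_inner_real_smul]
    exact mul_le_mul_of_nonneg_left (h2 i h) (sq_nonneg _)
  · rw [re_inner_real_smul, inner_smul_left, norm_mul, RCLike.norm_conj, mul_pow]
    exact mul_le_mul_of_nonneg_left (h3 h) (sq_nonneg _)
  · rw [re_inner_real_smul, mul_pow, gauge_sq hL]

theorem dualSANorm_smul (c : ℂ) (g : H2 d) : dualSANorm (c • g) = ‖c‖ * dualSANorm g := by
  refine le_antisymm (dualSANorm_smul_le c g) ?_
  rcases eq_or_ne c 0 with rfl | hc
  · simpa using dualSANorm_nonneg (0 : H2 d)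
  have h := dualSANorm_smul_le c⁻¹ (c • g)
  rwa [inv_smul_smul₀ hc, norm_inv, ← div_eq_inv_mul, le_div_iff₀' (norm_pos_iff.2 hc)] at h

/-- The difference of the two sides is a square over `s t`. The weights give equality at `a = s`, `b
= t`, which is what the triangle inequality needs. -/
theorem add_sq_le_mul_add_div {a b s t : ℝ} (hs : 0 < s) (ht : 0 < t) :
    (a + b) ^ 2 ≤ (1 + t / s) * a ^ 2 + (1 + s / t) * b ^ 2 := by
  have h : (1 + t / s) * a ^ 2 + (1 + s / t) * b ^ 2 - (a + b) ^ 2 = (t * a - s * b) ^ 2 / (s * t) := by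
    field_simp
    ring
  have : 0 ≤ (t * a - s * b) ^ 2 / (s * t) := by positivity
  linarith

theorem dualSANorm_add_le (g k : H2 d) : dualSANorm (g + k) ≤ dualSANorm g + dualSANorm k := by
  refine le_of_forall_pos_le_add fun ε hε => ?_
  -- The extra `ε / 2` makes `s` and `t` positive, so that the weights `1 + t / s` and `1 + s / t`
  -- are defined, and leaves room for near-optimal `A` and `B`.
  set s := dualSANorm g + ε / 2 with hs
  set t := dualSANorm k + ε / 2 with ht
  have hs0 : 0 < s := by have := dualSANorm_nonneg g; positivity
  have ht0 : 0 < t := by have := dualSANorm_nonneg k; positivity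
  obtain ⟨A, hA, hAs⟩ := exists_gauge_lt (show dualSANorm g < s by linarith)
  obtain ⟨B, hB, hBt⟩ := exists_gauge_lt (show dualSANorm k < t by linarith)
  obtain ⟨a1, a2, a3⟩ := mem_LcAbove_iff.1 hA
  obtain ⟨b1, b2, b3⟩ := mem_LcAbove_iff.1 hB
  have hq : ∀ h : H2 d, (inner ℂ h ((((1 + t / s : ℝ) : ℂ) • A + ((1 + s / t : ℝ) : ℂ) • B) h)).re =
      (1 + t / s) * (inner ℂ h (A h)).re + (1 + s / t) * (inner ℂ h (B h)).re := fun h => by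
    rw [add_apply, inner_add_right, Complex.add_re, re_inner_real_smul,
      re_inner_real_smul]
  have hc1 : 0 ≤ 1 + t / s := by positivity
  have hc2 : 0 ≤ 1 + s / t := by positivity
  clear_value s t
  have : dualSANorm (g + k) ≤ s + t := by
    refine dualSANorm_le_of_sq (L := ((1 + t / s : ℝ) : ℂ) • A + ((1 + s / t : ℝ) : ℂ) • B)
      (mem_LcAbove_iff.2 ⟨(isSelfAdjoint_real_smul _ a1).add (isSelfAdjoint_real_smul _ b1),
        fun i h => ?_, fun h => ?_⟩) (add_pos hs0 ht0).le ?_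
    · rw [hq, hq]
      exact add_le_add (mul_le_mul_of_nonneg_left (a2 i h) hc1)
        (mul_le_mul_of_nonneg_left (b2 i h) hc2)
    · rw [hq, inner_add_left]
      refine (pow_le_pow_left₀ (norm_nonneg _) (norm_add_le _ _) 2).trans
        ((add_sq_le_mul_add_div hs0 ht0).trans ?_)
      exact add_le_add (mul_le_mul_of_nonneg_left (a3 h) hc1)
        (mul_le_mul_of_nonneg_left (b3 h) hc2)
    · rw [hq, ← gauge_sq hA, ← gauge_sq hB]
      have h1 := mul_le_mul_of_nonneg_left (pow_le_pow_left₀ (gauge_nonneg A) hAs.le 2) hc1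
      have h2 := mul_le_mul_of_nonneg_left (pow_le_pow_left₀ (gauge_nonneg B) hBt.le 2) hc2
      have h3 : (1 + t / s) * s ^ 2 + (1 + s / t) * t ^ 2 = (s + t) ^ 2 := by
        field_simp
        ring
      exact (add_le_add h1 h2).trans_eq h3
  linarith

theorem star_core (d : ℕ) : NormedSpace.Core ℂ (H2Star d) where
  norm_nonneg g := dualSANorm_nonneg (toStar.symm g)
  norm_smul c g := dualSANorm_smul c (toStar.symm g)
  norm_triangle g h := dualSANorm_add_le (toStar.symm g) (toStar.symm h)
  norm_eq_zero_iff g := by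
    constructor
    · intro h
      refine lp.ext (funext fun α => ?_)
      have := (norm_apply_le_dualSANorm (toStar.symm g) α).trans_eq h
      exact norm_le_zero_iff.1 this
    · rintro rfl
      refine le_antisymm ?_ (dualSANorm_nonneg _)
      refine (dualSANorm_le_norm _).trans_eq ?_
      rw [map_zero, norm_zero]

/-! ### Monomials in commuting operators -/

section OpPow

variable {E : Type} [NormedAddCommGroup E] [InnerProductSpace ℂ E]

theorem opPow_succ (T : Fin (d + 1) → E →L[ℂ] E) (α : Fin (d + 1) → ℕ) :
    opPow T α = T 0 ^ α 0 * opPow (Fin.tail T) (Fin.tail α) := by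
  simp [opPow, List.ofFn_succ, Fin.tail]

theorem opPow_zero (T : Fin d → E →L[ℂ] E) : opPow T 0 = 1 := by
  simp [opPow]

/-- The product in `opPow` is ordered, so commutativity is needed to move `T i` past the earlier
factors to its own power. -/
theorem mul_opPow : ∀ {d : ℕ} {T : Fin d → E →L[ℂ] E}, (∀ i j, Commute (T i) (T j)) →
    ∀ (α : Fin d → ℕ) (i : Fin d),
    T i * opPow T α = opPow T (Function.update α i (α i + 1))
  | 0, _, _, _, i => i.elim0
  | d + 1, T, hT, α, i => by
    rw [opPow_succ, opPow_succ]
    refine Fin.cases ?_ (fun j => ?_) i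
    · have : Fin.tail (Function.update α 0 (α 0 + 1)) = Fin.tail α := by
        funext k
        simp [Fin.tail]
      rw [this, Function.update_self, pow_succ', mul_assoc]
    · have h1 : Fin.tail (Function.update α j.succ (α j.succ + 1)) =
          Function.update (Fin.tail α) j (Fin.tail α j + 1) := by
        rw [Fin.tail_update_succ]
        rfl
      rw [h1, ← mul_opPow (T := Fin.tail T) (fun i j => hT i.succ j.succ), Function.update_of_ne
        (Fin.succ_ne_zero j).symm, ← mul_assoc, ← mul_assoc]
      congr 1
      exact ((hT j.succ 0).pow_right _).eq

theorem opPow_smul (c : ℂ) {T : Fin d → E →L[ℂ] E} (hT : ∀ i j, Commute (T i) (T j))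
    (α : Fin d → ℕ) : opPow (fun i => c • T i) α = (∏ i, c ^ α i) • opPow T α := by
  have hT' : ∀ i j, Commute (c • T i) (c • T j) := fun i j =>
    ((hT i j).smul_left c).smul_right c
  induction α using multiIndex_induction with
  | h0 => simp [opPow_zero]
  | hs α i ih =>
    rw [← mul_opPow hT', ih, ← mul_opPow hT, smul_mul_smul_comm]
    congr 1
    rw [← Finset.mul_prod_erase _ _ (Finset.mem_univ i),
      ← Finset.mul_prod_erase _ (fun j => c ^ (Function.update α i (α i + 1)) j)
        (Finset.mem_univ i), Function.update_self, pow_succ', mul_assoc]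
    congr 2
    refine Finset.prod_congr rfl fun j hj => ?_
    rw [Function.update_of_ne (Finset.ne_of_mem_erase hj)]

/-- If `e` intertwines the coordinate multiplications with `T`, then it carries monomials to the
orbit of `e 1`. -/
theorem opPow_apply_of_intertwining {T : Fin d → E →L[ℂ] E} (hT : ∀ i j, Commute (T i) (T j))
    (e : H2 d → E) (he : ∀ i h, T i (e h) = e (Mz i h)) (α : Fin d → ℕ) :
    opPow T α (e (one d)) = e (mono α) := by
  induction α using multiIndex_induction with
  | h0 => rw [opPow_zero, one_apply_eq_self]
  | hs α i ih => rw [← mul_opPow hT, mul_apply_eq_comp, ih, he, Mz_mono]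

end OpPow

/-! ### Hardy space elements as holomorphic functions -/

theorem isPowerSeries_toFun (h : H2 d) : IsPowerSeries h (toFun h) :=
  fun z => (H2.summable_mpow h z).hasSum

theorem coeff_toFun (h : H2 d) : coeff (toFun h) = h := (isPowerSeries_toFun h).coeff_eq

theorem toFun_injective : Function.Injective (toFun : H2 d → polydisc d → ℂ) := fun g h hgh =>
  lp.ext (by rw [← coeff_toFun g, hgh, coeff_toFun])

theorem Mz_commute (i j : Fin d) : Commute (Mz i) (Mz j : H2 d →L[ℂ] H2 d) := by
  ext h α
  simp only [mul_apply_eq_comp, Mz_apply, shift]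
  rcases eq_or_ne i j with rfl | hij
  · rfl
  · simp only [Function.update_of_ne hij, Function.update_of_ne hij.symm]
    rw [Function.update_comm hij]
    split_ifs <;> rfl

/-- In `t ^ n - s ^ n = (t - s) ∑ t ^ i s ^ (n - 1 - i)` each of the `n` summands is at least `s ^
(n - 1)`. Derivatives of monomials on radius `s` are thus controlled by a geometric series of ratio
`t`. -/
theorem natCast_mul_pow_le {s t : ℝ} (hs : 0 ≤ s) (hst : s < t) (n : ℕ) :
    n * s ^ (n - 1) ≤ (t - s)⁻¹ * t ^ n := by
  rw [inv_mul_eq_div, le_div_iff₀ (sub_pos.2 hst)]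
  rcases n with _ | n
  · simp
  have h := (Commute.all t s).geom_sum₂_mul (n + 1)
  have h1 : ((n + 1 : ℕ) : ℝ) * s ^ n ≤ ∑ i ∈ Finset.range (n + 1), t ^ i * s ^ (n + 1 - 1 - i) := by
    rw [← nsmul_eq_mul, ← Finset.card_range (n + 1), ← Finset.sum_const, Finset.card_range]
    refine Finset.sum_le_sum fun i hi => ?_
    have hi' : i + (n - i) = n := by have := Finset.mem_range.1 hi; omega
    calc s ^ n = s ^ i * s ^ (n - i) := by rw [← pow_add, hi']
      _ ≤ t ^ i * s ^ (n + 1 - 1 - i) := by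
        rw [Nat.add_sub_cancel]
        gcongr
  have h2 := mul_le_mul_of_nonneg_right h1 (sub_pos.2 hst).le
  rw [h] at h2
  have h3 : 0 ≤ s ^ (n + 1) := by positivity
  simp only [Nat.add_sub_cancel]
  linarith

theorem differentiableOn_tsum_mpow {a : (Fin d → ℕ) → ℂ} {C : ℝ} (ha : ∀ α, ‖a α‖ ≤ C) :
    DifferentiableOn ℂ (fun z : Fin d → ℂ => ∑' α, a α * mpow z α) (polydisc d) := by
  intro z hz
  obtain ⟨s, hs0, hs1, hs⟩ : ∃ s : ℝ, 0 < s ∧ s < 1 ∧ ‖z‖ < s := by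
    obtain ⟨s, hs, hs1⟩ := exists_between ((pi_norm_lt_iff (x := z) one_pos).2 hz)
    exact ⟨s, (norm_nonneg z).trans_lt hs, hs1, hs⟩
  obtain ⟨t, hst, ht1⟩ := exists_between hs1
  have ht0 := hs0.trans hst
  have hC : 0 ≤ C := (norm_nonneg _).trans (ha 0)
  have hgeo := summable_geometric (d := d) (fun _ => t) (fun _ => ht0.le) (fun _ => ht1)
  have hder : ∀ (α : Fin d → ℕ) (w : Fin d → ℂ), HasFDerivAt (fun z => a α * mpow z α)
      (a α • ∑ i, (∏ j ∈ Finset.univ.erase i, w j ^ α j) •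
        ((α i * w i ^ (α i - 1)) • ContinuousLinearMap.proj (R := ℂ) (φ := fun _ : Fin d => ℂ) i)) w := by
    intro α w
    refine HasFDerivAt.const_mul ?_ _
    exact HasFDerivAt.finsetProd (u := Finset.univ) (g := fun i (z : Fin d → ℂ) => z i ^ α i)
      (g' := fun i => (α i * w i ^ (α i - 1)) • ContinuousLinearMap.proj (R := ℂ)
        (φ := fun _ : Fin d => ℂ) i)
      fun i _ => (hasDerivAt_pow (α i) (w i)).comp_hasFDerivAt w (hasFDerivAt_apply i w)
  have hnorm : ∀ w ∈ Metric.ball (0 : Fin d → ℂ) s, ∀ i, ‖w i‖ ≤ s := fun w hw i =>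
    (norm_le_pi_norm w i).trans (mem_ball_zero_iff.1 hw).le
  -- Termwise differentiation on the sup-norm ball of radius `s`. The factor `d` counts the partial
  -- derivatives, each bounded by `(t - s)⁻¹ ∏ t ^ α i`.
  refine (hasFDerivAt_tsum_of_isPreconnected (x₀ := z)
    (hgeo.mul_left (C * (d * (t - s)⁻¹))) Metric.isOpen_ball
    (convex_ball (0 : Fin d → ℂ) s).isPreconnected (fun α w _ => hder α w) (fun α w hw => ?_)
    (mem_ball_zero_iff.2 hs) ?_ (mem_ball_zero_iff.2 hs)).differentiableAt.differentiableWithinAt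
  · rw [norm_smul, mul_assoc]
    refine mul_le_mul (ha α) ?_ (norm_nonneg _) hC
    have hterm : ∀ i ∈ Finset.univ, ‖(∏ j ∈ Finset.univ.erase i, w j ^ α j) •
        ((α i * w i ^ (α i - 1)) • ContinuousLinearMap.proj (R := ℂ) (φ := fun _ : Fin d => ℂ) i)‖ ≤
        (t - s)⁻¹ * ∏ i, t ^ α i := by
      intro i _
      rw [norm_smul, norm_smul, norm_prod, norm_mul, ← Finset.mul_prod_erase _ _ (Finset.mem_univ i)]
      have h1 : ‖ContinuousLinearMap.proj (R := ℂ) (φ := fun _ : Fin d => ℂ) i‖ ≤ 1 :=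
        ContinuousLinearMap.opNorm_le_bound _ zero_le_one fun z => by
          simpa using norm_le_pi_norm z i
      have h2 : ‖(α i : ℂ)‖ * ‖w i ^ (α i - 1)‖ ≤ (t - s)⁻¹ * t ^ α i := by
        refine le_trans ?_ (natCast_mul_pow_le hs0.le hst (α i))
        rw [norm_pow, Complex.norm_natCast]
        gcongr
        exact hnorm w hw i
      have h3 : ∏ j ∈ Finset.univ.erase i, ‖w j ^ α j‖ ≤ ∏ j ∈ Finset.univ.erase i, t ^ α j := by
        refine Finset.prod_le_prod (fun _ _ => norm_nonneg _) fun j _ => ?_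
        rw [norm_pow]
        exact pow_le_pow_left₀ (norm_nonneg _) ((hnorm w hw j).trans hst.le) _
      have h4 : 0 ≤ (t - s)⁻¹ * t ^ α i := by have := sub_pos.2 hst; positivity
      have h5 := mul_le_mul h2 h1 (norm_nonneg _) h4
      rw [mul_one] at h5
      exact (mul_comm _ _).le.trans ((mul_le_mul h5 h3
        (Finset.prod_nonneg fun _ _ => norm_nonneg _) h4).trans_eq (mul_assoc _ _ _))
    refine (norm_sum_le_of_le _ hterm).trans_eq ?_
    rw [Finset.sum_const, Finset.card_univ, Fintype.card_fin, nsmul_eq_mul, mul_assoc]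
  · refine Summable.of_norm_bounded (hgeo.mul_left C) fun α => ?_
    rw [norm_mul]
    refine mul_le_mul (ha α) ?_ (norm_nonneg _) hC
    rw [mpow, norm_prod]
    refine Finset.prod_le_prod (fun _ _ => norm_nonneg _) fun j _ => ?_
    rw [norm_pow]
    exact pow_le_pow_left₀ (norm_nonneg _)
      ((hnorm z (mem_ball_zero_iff.2 hs) j).trans hst.le) _

/-- A power series with square summable coefficients is holomorphic on the polydisc. -/
theorem isHolomorphic_toFun (h : H2 d) : IsHolomorphic (toFun h) :=
  ⟨_, differentiableOn_tsum_mpow fun α => lp.norm_apply_le_norm two_ne_zero h α, fun _ => rfl⟩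

theorem exists_norm_sq_eq_re_inner {H : Type*} [NormedAddCommGroup H] [InnerProductSpace ℂ H]
    [CompleteSpace H] {A : H →L[ℂ] H} (hA : 0 ≤ A) :
    ∃ B : H →L[ℂ] H, ∀ h, ‖B h‖ ^ 2 = (inner ℂ h (A h)).re := by
  refine ⟨CFC.sqrt A, fun h => ?_⟩
  have h1 : IsSelfAdjoint (CFC.sqrt A) := isSelfAdjoint_of_nonneg (CFC.sqrt_nonneg A)
  have h2 : CFC.sqrt A (CFC.sqrt A h) = A h := by
    rw [← mul_apply_eq_comp, CFC.sqrt_mul_sqrt_self A hA]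
  rw [← h2, ← ContinuousLinearMap.adjoint_inner_left, h1.adjoint_eq]
  exact (inner_self_eq_norm_sq (𝕜 := ℂ) _).symm

/-! ### Orbit maps and the upper bound for the Schur--Agler norm -/

section

variable {E : Type} [NormedAddCommGroup E] [InnerProductSpace ℂ E]

theorem opEval_toFun (h : H2 d) (T : Fin d → E →L[ℂ] E) :
    opEval (toFun h) T = ∑' α, h α • opPow T α := by
  rw [opEval, coeff_toFun]

theorem opEval_toFun_one (T : Fin d → E →L[ℂ] E) : opEval (toFun (one d)) T = 1 := by
  rw [opEval_toFun, tsum_eq_single 0 fun α hα => by rw [mono_apply, if_neg hα, zero_smul],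
    mono_apply, if_pos rfl, one_smul, opPow_zero]

variable [CompleteSpace E]

/-- The operator `‖y‖² V* V` is admissible for `V* y`: the hypothesis on `V` puts it in the cone,
and Cauchy--Schwarz gives the domination. -/
theorem dualSANorm_adjoint_le (V : H2 d →L[ℂ] E) (hV : ∀ i h, ‖V (Mz i h)‖ ≤ ‖V h‖) (y : E) :
    dualSANorm (V.adjoint y) ≤ ‖y‖ * ‖V (one d)‖ := by
  have hq : ∀ h, (inner ℂ h ((((‖y‖ ^ 2 : ℝ) : ℂ) • (V.adjoint ∘L V)) h)).re =
      (‖y‖ * ‖V h‖) ^ 2 := fun h => by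
    rw [re_inner_real_smul, ContinuousLinearMap.comp_apply,
      ContinuousLinearMap.adjoint_inner_right, mul_pow]
    congr 1
    exact inner_self_eq_norm_sq (𝕜 := ℂ) (V h)
  refine dualSANorm_le_of_sq (L := ((‖y‖ ^ 2 : ℝ) : ℂ) • (V.adjoint ∘L V))
    (mem_LcAbove_iff.2 ⟨isSelfAdjoint_real_smul _
      (ContinuousLinearMap.isPositive_adjoint_comp_self V).isSelfAdjoint,
      fun i h => ?_, fun h => ?_⟩) (by positivity) (hq _).le
  · rw [hq, hq]
    have := hV i h
    gcongr
  · rw [hq, ContinuousLinearMap.adjoint_inner_left]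
    exact pow_le_pow_left₀ (norm_nonneg _) (norm_inner_le_norm y (V h)) 2

/-- Reindexing along `α ↦ α + e_i`; the coefficients of `z_i h` outside the range of this map
vanish. -/
theorem opEval_toFun_Mz {T : Fin d → E →L[ℂ] E} (hT : ∀ i j, Commute (T i) (T j))
    (hT' : ∀ i, ‖T i‖ < 1) (i : Fin d) (h : H2 d) :
    opEval (toFun (Mz i h)) T = T i * opEval (toFun h) T := by
  have hs := summable_opEval (isHolomorphic_toFun h) T hT'
  rw [coeff_toFun] at hs
  rw [opEval_toFun, opEval_toFun, ← hs.tsum_mul_left, ← (shift_injective i).tsum_eq]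
  · refine tsum_congr fun α => ?_
    rw [← mul_opPow hT, mul_smul_comm]
    simp [Mz_apply, shift]
  · intro α hα
    by_contra h0
    exact hα (by simp [Mz_apply, shift_eq_zero i h α h0])

/-- The orbit map `h ↦ h(T) x`. -/
theorem exists_orbitMap {T : Fin d → E →L[ℂ] E} (hT' : ∀ i, ‖T i‖ < 1) (x : E) :
    ∃ V : H2 d →L[ℂ] E, ∀ h, V h = opEval (toFun h) T x := by
  have hs : ∀ h : H2 d, Summable fun α => h α • opPow T α := fun h => by
    simpa only [coeff_toFun] using summable_opEval (isHolomorphic_toFun h) T hT'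
  have hgeo := summable_geometric (fun i => ‖T i‖) (fun i => norm_nonneg _) hT'
  refine ⟨LinearMap.mkContinuous
    { toFun := fun h => opEval (toFun h) T x
      map_add' := fun g h => ?_
      map_smul' := fun c h => ?_ } ((∑' α : Fin d → ℕ, ∏ i, ‖T i‖ ^ α i) * ‖x‖) fun h => ?_,
    fun h => rfl⟩
  · rw [opEval_toFun, opEval_toFun, opEval_toFun, ← add_apply, ← (hs g).tsum_add (hs h)]
    simp only [lp.coeFn_add, Pi.add_apply, add_smul]
  · rw [opEval_toFun, opEval_toFun, RingHom.id_apply, ← smul_apply, ← (hs h).tsum_const_smul c]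
    simp only [lp.coeFn_smul, Pi.smul_apply, smul_assoc]
  · change ‖opEval (toFun h) T x‖ ≤ _
    rw [opEval_toFun]
    have h1 : ‖∑' α, h α • opPow T α‖ ≤ ‖h‖ * ∑' α : Fin d → ℕ, ∏ i, ‖T i‖ ^ α i := by
      refine tsum_of_norm_bounded (hgeo.hasSum.mul_left ‖h‖) fun α => ?_
      rw [norm_smul]
      exact mul_le_mul (lp.norm_apply_le_norm two_ne_zero h α) (norm_opPow_le T α)
        (norm_nonneg _) (norm_nonneg _)
    refine (ContinuousLinearMap.le_opNorm _ _).trans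
      ((mul_le_mul_of_nonneg_right h1 (norm_nonneg _)).trans_eq ?_)
    ring

end

theorem saNorm_toFun_le {f : H2 d} {S : ℝ} (hS : 0 ≤ S)
    (h : ∀ g : H2 d, ‖inner ℂ g f‖ ≤ S * dualSANorm g) :
    saNorm (toFun f) ≤ ENNReal.ofReal S := by
  refine iSup_le fun E => iSup_le fun _ => iSup_le fun _ => iSup_le fun _ =>
    iSup_le fun T => iSup_le fun hT => iSup_le fun hT' => ?_
  rw [← ofReal_norm]
  refine ENNReal.ofReal_le_ofReal (ContinuousLinearMap.opNorm_le_bound _ hS fun x => ?_)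
  obtain ⟨V, hV⟩ := exists_orbitMap hT' x
  rw [← hV]
  rcases eq_or_ne (V f) 0 with h0 | h0
  · rw [h0, norm_zero]
    positivity
  -- Pairing `V* V f` with `f` produces `‖V f‖²`; one factor `‖V f‖` cancels at the end, hence the
  -- separate case `V f = 0`.
  have h1 := h (V.adjoint (V f))
  rw [ContinuousLinearMap.adjoint_inner_left, inner_self_eq_norm_sq_to_K, norm_pow,
    RCLike.norm_ofReal, abs_norm] at h1
  have h2 := dualSANorm_adjoint_le V (fun i h => by
    rw [hV, hV, opEval_toFun_Mz hT hT', mul_apply_eq_comp]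
    refine (ContinuousLinearMap.le_opNorm _ _).trans
      (mul_le_of_le_one_left (norm_nonneg _) (hT' i).le)) (V f)
  rw [hV (one d), opEval_toFun_one, one_apply_eq_self] at h2
  have h3 := h1.trans (mul_le_mul_of_nonneg_left h2 hS)
  have h4 := norm_pos_iff.2 h0
  refine le_of_mul_le_mul_left ?_ h4
  linarith

/-! ### Dilations, the GNS construction and the lower bound -/

theorem tendsto_prod_pow (α : Fin d → ℕ) :
    Tendsto (fun r : ℝ => ∏ i, (r : ℂ) ^ α i) (𝓝[<] 1) (𝓝 1) := by
  have h : Continuous fun r : ℝ => ∏ i, (r : ℂ) ^ α i := by fun_prop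
  simpa using (h.tendsto 1).mono_left nhdsWithin_le_nhds

theorem eventually_mem_Ioo : ∀ᶠ r : ℝ in 𝓝[<] 1, 0 < r ∧ r < 1 :=
  Ioo_mem_nhdsLT zero_lt_one

/-- Dominated convergence as `r → 1` from below, with the summable family `‖⟨g α, f α⟩‖` as
majorant. Dilating is necessary because the GNS tuple is only contractive, not strictly so. -/
theorem norm_inner_le_of_dilates {g f : H2 d} {K : ℝ}
    (h : ∀ r : ℝ, 0 < r → r < 1 →
      ‖∑' α, (∏ i, (r : ℂ) ^ α i) * inner ℂ (g α) (f α)‖ ≤ K) : ‖inner ℂ g f‖ ≤ K := by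
  have hs := (lp.summable_inner (𝕜 := ℂ) g f).norm
  have ht : Tendsto (fun r : ℝ => ∑' α, (∏ i, (r : ℂ) ^ α i) * inner ℂ (g α) (f α)) (𝓝[<] 1)
      (𝓝 (∑' α, inner ℂ (g α) (f α))) := by
    refine tendsto_tsum_of_dominated_convergence hs (fun α => ?_) ?_
    · simpa using (tendsto_prod_pow α).mul_const (inner ℂ (g α) (f α))
    · filter_upwards [eventually_mem_Ioo] with r hr α
      rw [norm_mul, norm_prod]
      refine mul_le_of_le_one_left (norm_nonneg _) (Finset.prod_le_one (fun _ _ => norm_nonneg _)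
        fun i _ => ?_)
      rw [norm_pow, Complex.norm_real, Real.norm_of_nonneg hr.1.le]
      exact pow_le_one₀ hr.1.le hr.2.le
  rw [lp.inner_eq_tsum]
  refine le_of_tendsto ht.norm ?_
  filter_upwards [eventually_mem_Ioo] with r hr
  exact h r hr.1 hr.2

theorem norm_opEval_le {f : polydisc d → ℂ} {S : ℝ} (hS : 0 ≤ S)
    (hf : saNorm f ≤ ENNReal.ofReal S) {E : Type} [NormedAddCommGroup E] [InnerProductSpace ℂ E]
    [CompleteSpace E] {T : Fin d → E →L[ℂ] E}
    (hT : ∀ i j, Commute (T i) (T j)) (hT' : ∀ i, ‖T i‖ < 1) : ‖opEval f T‖ ≤ S := by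
  have h := (enorm_opEval_le f T hT hT').trans hf
  rwa [← ofReal_norm, ENNReal.ofReal_le_ofReal_iff hS] at h

theorem commute_smul_smul {E : Type} [NormedAddCommGroup E] [InnerProductSpace ℂ E]
    {S T : E →L[ℂ] E} (h : Commute S T) (c : ℂ) : Commute (c • S) (c • T) :=
  (h.smul_left c).smul_right c

theorem norm_smul_lt_one {E : Type} [NormedAddCommGroup E] [InnerProductSpace ℂ E]
    {T : E →L[ℂ] E} (hT : ‖T‖ ≤ 1) {r : ℝ} (hr0 : 0 < r) (hr1 : r < 1) :
    ‖(r : ℂ) • T‖ < 1 := by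
  rw [norm_smul, Complex.norm_real, Real.norm_of_nonneg hr0.le]
  exact (mul_le_of_le_one_right hr0.le hT).trans_lt hr1

/-- The GNS space of the form `⟨L h, h⟩` is realised as the closure of the range of `B = L^(1/2)`,
the class of `h` being `B h`. -/
theorem norm_inner_le_mul_gauge {f g : H2 d} {S : ℝ} (hS : 0 ≤ S)
    (hf : saNorm (toFun f) ≤ ENNReal.ofReal S) {L : H2 d →L[ℂ] H2 d} (hL : L ∈ LcAbove g) :
    ‖inner ℂ g f‖ ≤ S * gauge L := by
  obtain ⟨-, hM, hg⟩ := mem_LcAbove_iff.1 hL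
  obtain ⟨B, hBL⟩ := exists_norm_sq_eq_re_inner hL.1.1
  let E : Submodule ℂ (H2 d) := B.range.topologicalClosure
  have : CompleteSpace E := B.range.isClosed_topologicalClosure.completeSpace_coe
  let e : H2 d →L[ℂ] E := B.codRestrict E fun h => subset_closure ⟨h, rfl⟩
  have hen : ∀ h, ‖e h‖ = ‖B h‖ := fun h => rfl
  have hed : DenseRange e := by
    refine Subtype.dense_iff.2 ?_
    rw [← Set.range_comp]
    exact fun x hx => hx
  have hMn : ∀ i h, ‖(e.toLinearMap ∘ₗ (Mz i).toLinearMap) h‖ ≤ 1 * ‖e h‖ := fun i h => by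
    rw [one_mul]
    refine le_of_sq_le_sq ?_ (norm_nonneg _)
    change ‖B (Mz i h)‖ ^ 2 ≤ ‖B h‖ ^ 2
    rw [hBL, hBL]
    exact hM i h
  -- The bound `hMn` makes `B h ↦ B (z_i h)` well defined and contractive on the dense range, hence
  -- extendable to `E`.
  let T : Fin d → E →L[ℂ] E := fun i =>
    (e.toLinearMap ∘ₗ (Mz i).toLinearMap).extendOfNorm e.toLinearMap
  have hTe : ∀ i h, T i (e h) = e (Mz i h) := fun i h =>
    LinearMap.extendOfNorm_eq hed ⟨1, hMn i⟩ h
  have hTn : ∀ i, ‖T i‖ ≤ 1 := fun i => LinearMap.opNorm_extendOfNorm_le hed zero_le_one (hMn i)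
  have hTc : ∀ i j, Commute (T i) (T j) := fun i j => by
    refine ContinuousLinearMap.ext (congrFun (hed.equalizer (T i * T j).continuous
      (T j * T i).continuous (funext fun h => ?_)))
    simp only [Function.comp_apply, mul_apply_eq_comp, hTe]
    rw [← mul_apply_eq_comp, (Mz_commute i j).eq, mul_apply_eq_comp]
  have hgn : ∀ h, ‖(innerSL ℂ g).toLinearMap h‖ ≤ 1 * ‖e h‖ := fun h => by
    rw [one_mul]
    refine le_of_sq_le_sq ?_ (norm_nonneg _)
    rw [hen, hBL]
    exact hg h
  -- The inequality `L ≥ g ⊗ g` says that `B h ↦ ⟨h, g⟩` is a well-defined contraction.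
  let φ : E →L[ℂ] ℂ := (innerSL ℂ g).toLinearMap.extendOfNorm e.toLinearMap
  have hφe : ∀ h, φ (e h) = inner ℂ g h := fun h =>
    LinearMap.extendOfNorm_eq hed ⟨1, hgn⟩ h
  have hφn : ‖φ‖ ≤ 1 := LinearMap.opNorm_extendOfNorm_le hed zero_le_one hgn
  refine norm_inner_le_of_dilates fun r hr0 hr1 => ?_
  have hrT : ∀ i, ‖(r : ℂ) • T i‖ < 1 := fun i => norm_smul_lt_one (hTn i) hr0 hr1
  have h1 : φ (opEval (toFun f) (fun i => (r : ℂ) • T i) (e (one d))) =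
      ∑' α, (∏ i, (r : ℂ) ^ α i) * inner ℂ (g α) (f α) := by
    have h2 := (φ ∘L ContinuousLinearMap.apply ℂ E (e (one d))).map_tsum
      (summable_opEval (isHolomorphic_toFun f) _ hrT)
    refine h2.trans (tsum_congr fun α => ?_)
    rw [coeff_toFun, opPow_smul _ hTc, ContinuousLinearMap.comp_apply,
      ContinuousLinearMap.apply_apply, smul_apply, smul_apply,
      opPow_apply_of_intertwining hTc e hTe, map_smul, map_smul, hφe, inner_mono_right]
    simp only [smul_eq_mul, RCLike.inner_apply]
    ring
  rw [← h1]
  have h3 := norm_opEval_le hS hf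
    (fun i j => commute_smul_smul (hTc i j) r) hrT
  have h4 : ‖e (one d)‖ ≤ gauge L := by
    refine le_of_sq_le_sq ?_ (gauge_nonneg L)
    rw [hen, hBL, gauge_sq hL]
  calc _ ≤ ‖φ‖ * (‖opEval (toFun f) (fun i => (r : ℂ) • T i)‖ * ‖e (one d)‖) :=
        (φ.le_opNorm _).trans
          (mul_le_mul_of_nonneg_left (ContinuousLinearMap.le_opNorm _ _) (norm_nonneg _))
    _ ≤ 1 * (S * gauge L) := by gcongr
    _ = S * gauge L := one_mul _

theorem saNorm_toFun_le_iff {f : H2 d} {S : ℝ} (hS : 0 ≤ S) :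
    saNorm (toFun f) ≤ ENNReal.ofReal S ↔ ∀ g : H2 d, ‖inner ℂ g f‖ ≤ S * dualSANorm g := by
  refine ⟨fun h g => ?_, saNorm_toFun_le hS⟩
  refine le_of_forall_pos_le_add fun ε hε => ?_
  -- Dividing by `S + 1` rather than `S` covers `S = 0`.
  obtain ⟨L, hL, hLt⟩ := exists_gauge_lt (show dualSANorm g < dualSANorm g + ε / (S + 1) by
    have : 0 < ε / (S + 1) := by positivity
    linarith)
  refine (norm_inner_le_mul_gauge hS h hL).trans ((mul_le_mul_of_nonneg_left hLt.le hS).trans ?_)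
  rw [mul_add]
  gcongr
  rw [mul_div_left_comm]
  exact mul_le_of_le_one_right hε.le ((div_le_one (by positivity)).2 (by linarith))

/-! ### The Schur--Agler space lies in the Hardy space -/

theorem opPow_mono (α : Fin d → ℕ) : opPow Mz α (one d) = mono α :=
  opPow_apply_of_intertwining Mz_commute id (fun _ _ => rfl) α

/-- Functions in the Schur--Agler space belong to the Hardy space. -/
theorem exists_toFun_eq {f : polydisc d → ℂ} (hf : IsHolomorphic f) (hf' : saNorm f < ⊤) :
    ∃ h : H2 d, toFun h = f := by
  set S := (saNorm f).toReal
  have hS0 : 0 ≤ S := ENNReal.toReal_nonneg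
  have hS : saNorm f ≤ ENNReal.ofReal S := (ENNReal.ofReal_toReal hf'.ne).ge
  -- The vector `f(r M_z) 1` has coefficients `r ^ |α| a_α` and norm at most `S`. Finite partial
  -- sums therefore stay below `S ^ 2`, also in the limit `r → 1`.
  have hmem : Memℓp (coeff f) 2 := by
    refine memℓp_gen' (C := S ^ (2 : ENNReal).toReal) fun F => ?_
    have ht : Tendsto (fun r : ℝ => ∑ α ∈ F,
        ‖coeff f α * ∏ i, (r : ℂ) ^ α i‖ ^ (2 : ENNReal).toReal) (𝓝[<] 1)
        (𝓝 (∑ α ∈ F, ‖coeff f α‖ ^ (2 : ENNReal).toReal)) := by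
      refine tendsto_finsetSum _ fun α _ => ?_
      refine Tendsto.rpow_const ?_ (Or.inr (by norm_num))
      simpa using ((tendsto_prod_pow α).const_mul (coeff f α)).norm
    refine le_of_tendsto ht ?_
    filter_upwards [eventually_mem_Ioo] with r hr
    have hrT : ∀ i : Fin d, ‖(r : ℂ) • Mz i‖ < 1 := fun i =>
      norm_smul_lt_one (ContinuousLinearMap.opNorm_le_bound _ zero_le_one
        fun h => by rw [norm_Mz, one_mul]) hr.1 hr.2
    have h1 : ‖opEval f (fun i => (r : ℂ) • Mz i) (one d)‖ ≤ S := by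
      refine (ContinuousLinearMap.le_opNorm _ _).trans ?_
      rw [norm_mono, mul_one]
      exact norm_opEval_le hS0 hS
        (fun i j => commute_smul_smul (Mz_commute i j) r) hrT
    have h2 : ∀ α, opEval f (fun i => (r : ℂ) • Mz i) (one d) α =
        coeff f α * ∏ i, (r : ℂ) ^ α i := fun α => by
      have h3 := (innerSL ℂ (mono α) ∘L ContinuousLinearMap.apply ℂ (H2 d) (one d)).map_tsum
        (summable_opEval hf _ hrT)
      rw [← inner_mono_left]
      refine h3.trans ((tsum_eq_single α fun β hβ => ?_).trans ?_)
      all_goals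
        rw [opPow_smul _ Mz_commute, ContinuousLinearMap.comp_apply,
          ContinuousLinearMap.apply_apply, smul_apply, smul_apply,
          opPow_mono, innerSL_apply_apply,
          inner_smul_right, inner_smul_right, inner_mono_left, mono_apply]
      · rw [if_neg hβ.symm, mul_zero, mul_zero]
      · rw [if_pos rfl, mul_one]
    have h4 := lp.sum_rpow_le_norm_rpow (p := 2) (by norm_num)
      (opEval f (fun i => (r : ℂ) • Mz i) (one d)) F
    simp only [h2] at h4
    exact h4.trans (Real.rpow_le_rpow (norm_nonneg _) h1 (by norm_num))
  refine ⟨⟨coeff f, hmem⟩, funext fun z => (hf.isPowerSeries z).tsum_eq⟩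

/-! ### Homogeneous projections and truncation -/

theorem mono_mem_P {n : ℕ} {α : Fin d → ℕ} (hα : ∑ i, α i = n) : mono α ∈ P d n :=
  Submodule.subset_span ⟨α, hα, rfl⟩

theorem apply_eq_zero_of_mem_P {n : ℕ} {h : H2 d} (hh : h ∈ P d n) {α : Fin d → ℕ}
    (hα : ∑ i, α i ≠ n) : h α = 0 := by
  induction hh using Submodule.span_induction with
  | mem x hx =>
    obtain ⟨β, hβ, rfl⟩ := hx
    rw [mono_apply, if_neg]
    rintro rfl
    exact hα hβ
  | zero => rfl
  | add x y _ _ hx hy => rw [lp.coeFn_add, Pi.add_apply, hx, hy, add_zero]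
  | smul c x _ hx => rw [lp.coeFn_smul, Pi.smul_apply, hx, smul_zero]

/-- The orthogonal projection onto the homogeneous polynomials of degree `n`. -/
noncomputable abbrev proj (d n : ℕ) : H2 d →L[ℂ] H2 d := (P d n).starProjection

theorem inner_proj_left (n : ℕ) (g h : H2 d) :
    inner ℂ (proj d n g) h = inner ℂ g (proj d n h) :=
  Submodule.inner_starProjection_left_eq_right _ g h

theorem proj_eq_self {n : ℕ} {h : H2 d} (hh : h ∈ P d n) : proj d n h = h :=
  Submodule.starProjection_eq_self_iff.2 hh

theorem proj_mem (n : ℕ) (h : H2 d) : proj d n h ∈ P d n :=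
  Submodule.starProjection_apply_mem _ h

theorem proj_mono (n : ℕ) (α : Fin d → ℕ) :
    proj d n (mono α) = if ∑ i, α i = n then mono α else 0 := by
  split_ifs with h
  · exact proj_eq_self (mono_mem_P h)
  · refine (Submodule.starProjection_apply_eq_zero_iff _).2 fun u hu => ?_
    rw [inner_mono_right, apply_eq_zero_of_mem_P hu h, map_zero]

theorem proj_apply (n : ℕ) (h : H2 d) (α : Fin d → ℕ) :
    proj d n h α = if ∑ i, α i = n then h α else 0 := by
  rw [← inner_mono_left, ← inner_proj_left, proj_mono]
  split_ifs
  · exact inner_mono_left α h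
  · exact inner_zero_left h

theorem sum_update_pred {α : Fin d → ℕ} {i : Fin d} (h : α i ≠ 0) :
    ∑ j, Function.update α i (α i - 1) j + 1 = ∑ j, α j := by
  rw [Finset.sum_update_of_mem (Finset.mem_univ i), ← Finset.erase_eq,
    ← Finset.add_sum_erase _ α (Finset.mem_univ i)]
  omega

theorem proj_succ_Mz (n : ℕ) (i : Fin d) (h : H2 d) :
    proj d (n + 1) (Mz i h) = Mz i (proj d n h) := by
  ext α
  rw [proj_apply, Mz_apply, Mz_apply, shift, shift]
  rcases eq_or_ne (α i) 0 with h0 | h0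
  · simp [h0]
  · rw [if_neg h0, if_neg h0, proj_apply, ← sum_update_pred h0]
    simp

theorem proj_zero_Mz (i : Fin d) (h : H2 d) : proj d 0 (Mz i h) = 0 := by
  ext α
  rw [proj_apply, Mz_apply, shift, lp.coeFn_zero, Pi.zero_apply]
  split_ifs with h1 h2
  · rfl
  · exact absurd (Finset.sum_eq_zero_iff.1 h1 i (Finset.mem_univ i)) h2
  · rfl

/-- The block diagonal part of `L` in degrees below `n`, with `q ⊗ q` in degree `n`, where `q` is
the homogeneous part of degree `n` of `g`. -/
noncomputable def truncate (n : ℕ) (g : H2 d) (L : H2 d →L[ℂ] H2 d) : H2 d →L[ℂ] H2 d :=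
  ∑ k ∈ Finset.range n, proj d k ∘L L ∘L proj d k + tensorSelf (proj d n g)

theorem re_inner_truncate (n : ℕ) (g : H2 d) (L : H2 d →L[ℂ] H2 d) (h : H2 d) :
    (inner ℂ h (truncate n g L h)).re =
      ∑ k ∈ Finset.range n, (inner ℂ (proj d k h) (L (proj d k h))).re +
        ‖inner ℂ g (proj d n h)‖ ^ 2 := by
  rw [truncate, add_apply, inner_add_right, Complex.add_re, re_inner_tensorSelf, inner_proj_left,
    sum_apply, inner_sum, Complex.re_sum]
  congr 1
  refine Finset.sum_congr rfl fun k _ => ?_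
  rw [inner_proj_left]
  rfl

/-- Multiplication by `z_i` raises the degree by one. Between degrees below `n` the inequality is
that of `L`; from `n - 1` to `n` it reads `|⟨z_i h, g⟩|² ≤ ⟨L z_i h, z_i h⟩ ≤ ⟨L h, h⟩`; beyond
degree `n` the truncation vanishes. -/
theorem truncate_mem_LcAbove {g : H2 d} {L : H2 d →L[ℂ] H2 d} (hL : L ∈ LcAbove g) (n : ℕ) :
    truncate n g L ∈ LcAbove (proj d n g) := by
  obtain ⟨h1, h2, h3⟩ := mem_LcAbove_iff.1 hL
  have h0 : ∀ h, 0 ≤ (inner ℂ h (L h)).re := fun h => (sq_nonneg _).trans (h3 h)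
  refine mem_LcAbove_iff.2 ⟨?_, fun i h => ?_, fun h => ?_⟩
  · refine IsSelfAdjoint.add (isSelfAdjoint_sum _ fun k _ => ?_) (isSelfAdjoint_tensorSelf _)
    have h4 := h1.adjoint_conj (proj d k)
    rwa [(isSelfAdjoint_starProjection (P d k)).adjoint_eq] at h4
  · rw [re_inner_truncate, re_inner_truncate]
    cases n with
    | zero =>
      rw [proj_zero_Mz]
      simp
    | succ n =>
      -- On the left the degree `0` block vanishes and the others shift down; on the right the block
      -- of degree `n` is split off to dominate the rank-one term.
      rw [Finset.sum_range_succ', proj_zero_Mz, Finset.sum_range_succ, map_zero, inner_zero_right,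
        Complex.zero_re, add_zero]
      simp only [proj_succ_Mz]
      have h4 := Finset.sum_le_sum fun k (_ : k ∈ Finset.range n) => h2 i (proj d k h)
      have h5 := (h3 (Mz i (proj d n h))).trans (h2 i _)
      exact (add_le_add h4 h5).trans (le_add_of_nonneg_right (sq_nonneg _))
  · rw [re_inner_truncate, inner_proj_left]
    exact le_add_of_nonneg_left (Finset.sum_nonneg fun k _ => h0 _)

/-- The constant `1` meets only the block of degree `0`. Replacing the rank-one term by the larger
`L`-block of degree `n` treats `n = 0` together with the other degrees. -/
theorem gauge_truncate_le {g : H2 d} {L : H2 d →L[ℂ] H2 d} (hL : L ∈ LcAbove g) (n : ℕ) :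
    gauge (truncate n g L) ≤ gauge L := by
  refine Real.sqrt_le_sqrt ?_
  rw [re_inner_truncate]
  refine (add_le_add_right ((mem_LcAbove_iff.1 hL).2.2 _) _).trans_eq ?_
  rw [← Finset.sum_range_succ, Finset.sum_eq_single 0]
  · rw [proj_mono, if_pos (by simp)]
  · intro k _ hk
    rw [proj_mono, if_neg (by simpa using hk.symm), inner_zero_left, Complex.zero_re]
  · simp

theorem truncate_mem_LcGradedAbove {g : H2 d} {L : H2 d →L[ℂ] H2 d} (hL : L ∈ LcAbove g)
    (n : ℕ) : truncate n g L ∈ LcGradedAbove n (proj d n g) := by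
  refine ⟨truncate_mem_LcAbove hL n, fun k => (P d k).orthogonalProjectionOnto ∘L
    (if k < n then L else tensorSelf (proj d n g)) ∘L (P d k).subtypeL, ?_⟩
  have hext : ∀ k (A : H2 d →L[ℂ] H2 d), extend k ((P d k).orthogonalProjectionOnto ∘L
      A ∘L (P d k).subtypeL) = proj d k ∘L A ∘L proj d k := fun k A => rfl
  have hn : proj d n ∘L tensorSelf (proj d n g) ∘L proj d n = tensorSelf (proj d n g) := by
    ext1 h
    simp only [ContinuousLinearMap.comp_apply, tensorSelf, InnerProductSpace.rankOne_apply,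
      map_smul, ← inner_proj_left, proj_eq_self (proj_mem n g)]
  simp only [hext]
  refine ⟨?_, by rw [if_neg (lt_irrefl n), hn]⟩
  rw [Finset.sum_range_succ, if_neg (lt_irrefl n), hn, truncate]
  congr 1
  refine Finset.sum_congr rfl fun k hk => ?_
  rw [if_pos (Finset.mem_range.1 hk)]

theorem dualSANorm_proj_le (n : ℕ) (g : H2 d) : dualSANorm (proj d n g) ≤ dualSANorm g :=
  le_dualSANorm fun _ hL =>
    (dualSANorm_le_gauge (truncate_mem_LcAbove hL n)).trans (gauge_truncate_le hL n)

theorem LcGradedAbove_subset (n : ℕ) (q : H2 d) :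
    LcGradedAbove n q ⊆ {L | L ∈ LcGraded d n ∧ tensorSelf q ≤ L} :=
  fun _ ⟨hL, A, hA, _⟩ => ⟨⟨hL.1, A, hA⟩, hL.2⟩

/-- Truncation sends every competitor for `q` into the smallest of the sets without raising the
gauge. Leaving `s` free handles both infima over graded operators at once. -/
theorem isGLB_gauge {n : ℕ} {q : H2 d} (hq : q ∈ P d n) {s : Set (H2 d →L[ℂ] H2 d)}
    (hs : s ⊆ LcAbove q) (hs' : LcGradedAbove n q ⊆ s) :
    IsGLB (gauge '' s) (dualSANorm q) := by
  refine ⟨?_, fun c hc => le_dualSANorm fun L hL => ?_⟩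
  · rintro _ ⟨L, hL, rfl⟩
    exact dualSANorm_le_gauge (hs hL)
  · have h := truncate_mem_LcGradedAbove hL n
    rw [proj_eq_self hq] at h
    exact (hc ⟨_, hs' h, rfl⟩).trans (gauge_truncate_le hL n)

/-- For `p` in `P_n` only the degree `n` part of `g` enters `⟨p, g⟩`, and passing to it does not
increase `‖g‖_*`. -/
theorem saNorm_toFun_le_iff_of_mem_P {n : ℕ} {p : H2 d} (hp : p ∈ P d n) {S : ℝ} (hS : 0 ≤ S) :
    saNorm (toFun p) ≤ ENNReal.ofReal S ↔
      ∀ q ∈ P d n, ‖inner ℂ q p‖ ≤ S * dualSANorm q := by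
  rw [saNorm_toFun_le_iff hS]
  refine ⟨fun h q _ => h q, fun h g => ?_⟩
  have h1 := h _ (proj_mem n g)
  rw [inner_proj_left, proj_eq_self hp] at h1
  exact h1.trans (mul_le_mul_of_nonneg_left (dualSANorm_proj_le n g) hS)

theorem toFun_mem_SA_of_le {f : H2 d} {S : ℝ} (hS : 0 ≤ S)
    (h : ∀ g : H2 d, ‖inner ℂ g f‖ ≤ S * dualSANorm g) : toFun f ∈ SA d :=
  ⟨isHolomorphic_toFun f, (saNorm_toFun_le hS h).trans_lt ENNReal.ofReal_lt_top⟩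

theorem toFun_mem_SA_of_mem_P {n : ℕ} {p : H2 d} (hp : p ∈ P d n) : toFun p ∈ SA d := by
  have h : P d n ≤ (SA d).comap toFun := by
    refine Submodule.span_le.2 ?_
    rintro _ ⟨α, -, rfl⟩
    -- Pairing with a monomial extracts a coefficient, which `‖g‖_*` bounds.
    refine toFun_mem_SA_of_le zero_le_one fun g => ?_
    rw [inner_mono_right, RCLike.norm_conj, one_mul]
    exact norm_apply_le_dualSANorm g α
  exact h hp

/-- An element of `[0, ∞]` is determined by the finite bounds it satisfies, so infinite values need
no separate theory. The subspace `K` will be all of `H²` or `P_n`. -/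
theorem eq_iSup_of_le_iff {K : Submodule ℂ (H2 d)} {f : H2 d} {X : ENNReal}
    (h : ∀ S : ℝ, 0 ≤ S →
      (X ≤ ENNReal.ofReal S ↔ ∀ g ∈ K, ‖inner ℂ g f‖ ≤ S * dualSANorm g)) :
    X = ⨆ (g : H2 d) (_ : g ∈ K) (_ : dualSANorm g ≤ 1), ‖inner ℂ g f‖ₑ := by
  refine le_antisymm ?_ (iSup_le fun g => iSup_le fun hg => iSup_le fun hg1 => ?_)
  · set Y := ⨆ (g : H2 d) (_ : g ∈ K) (_ : dualSANorm g ≤ 1), ‖inner ℂ g f‖ₑ with hY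
    rcases eq_or_ne Y ⊤ with hY' | hY'
    · exact hY' ▸ le_top
    rw [← ENNReal.ofReal_toReal hY', h _ ENNReal.toReal_nonneg]
    intro g hg
    rcases (dualSANorm_nonneg g).eq_or_lt' with h0 | h0
    · have : g = 0 := lp.ext (funext fun α =>
        norm_le_zero_iff.1 ((norm_apply_le_dualSANorm g α).trans_eq h0))
      rw [h0, this, inner_zero_left, norm_zero, mul_zero]
    · have h1 : ‖inner ℂ (((dualSANorm g)⁻¹ : ℂ) • g) f‖ₑ ≤ Y :=
        le_iSup_of_le _ <| le_iSup_of_le (K.smul_mem _ hg) <| le_iSup_of_le (le_of_eq (by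
          rw [dualSANorm_smul, norm_inv, Complex.norm_real, Real.norm_of_nonneg h0.le,
            inv_mul_cancel₀ h0.ne'])) le_rfl
      rw [← ofReal_norm, ENNReal.ofReal_le_iff_le_toReal hY', inner_smul_left, norm_mul,
        RCLike.norm_conj, norm_inv, Complex.norm_real, Real.norm_of_nonneg h0.le,
        inv_mul_le_iff₀ h0, mul_comm] at h1
      exact h1
  · rcases eq_or_ne X ⊤ with hX | hX
    · exact hX ▸ le_top
    have h1 := (h _ ENNReal.toReal_nonneg).1 (ENNReal.ofReal_toReal hX).ge g hg
    rw [← ofReal_norm, ENNReal.ofReal_le_iff_le_toReal hX]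
    exact h1.trans (mul_le_of_le_one_right ENNReal.toReal_nonneg hg1)

/-! ### The Schur--Agler norm is a norm -/

theorem exists_hardy (f : SA d) : ∃ h : H2 d, toFun h = (f : polydisc d → ℂ) :=
  exists_toFun_eq f.2.1 f.2.2

/-- A function in the Schur--Agler space as an element of the Hardy space. -/
noncomputable def hardy : SA d →ₗ[ℂ] H2 d where
  toFun f := (exists_hardy f).choose
  map_add' f g := toFun_injective (by
    rw [map_add, (exists_hardy f).choose_spec, (exists_hardy g).choose_spec,
      (exists_hardy (f + g)).choose_spec]
    rfl)
  map_smul' c f := toFun_injective (by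
    rw [RingHom.id_apply, map_smul, (exists_hardy f).choose_spec,
      (exists_hardy (c • f)).choose_spec]
    rfl)

theorem toFun_hardy (f : SA d) : toFun (hardy f) = (f : polydisc d → ℂ) :=
  (exists_hardy f).choose_spec

theorem hardy_eq {f : SA d} {h : H2 d} (hf : toFun h = (f : polydisc d → ℂ)) : hardy f = h :=
  toFun_injective ((toFun_hardy f).trans hf.symm)

theorem norm_SA_le_ofReal_iff {f : SA d} {S : ℝ} (hS : 0 ≤ S) :
    ‖f‖ ≤ S ↔ saNorm (toFun (hardy f)) ≤ ENNReal.ofReal S := by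
  rw [toFun_hardy, ENNReal.le_ofReal_iff_toReal_le f.2.2.ne hS]
  rfl

theorem norm_SA_le_iff {f : SA d} {S : ℝ} (hS : 0 ≤ S) :
    ‖f‖ ≤ S ↔ ∀ g : H2 d, ‖inner ℂ g (hardy f)‖ ≤ S * dualSANorm g :=
  (norm_SA_le_ofReal_iff hS).trans (saNorm_toFun_le_iff hS)

theorem norm_SA_nonneg (f : SA d) : 0 ≤ ‖f‖ := ENNReal.toReal_nonneg

theorem norm_inner_hardy_le (f : SA d) (g : H2 d) :
    ‖inner ℂ g (hardy f)‖ ≤ ‖f‖ * dualSANorm g :=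
  (norm_SA_le_iff (norm_SA_nonneg f)).1 le_rfl g

theorem norm_SA_smul_le (c : ℂ) (f : SA d) : ‖c • f‖ ≤ ‖c‖ * ‖f‖ := by
  refine (norm_SA_le_iff (mul_nonneg (norm_nonneg c) (norm_SA_nonneg f))).2 fun g => ?_
  rw [map_smul, inner_smul_right, norm_mul, mul_assoc]
  exact mul_le_mul_of_nonneg_left (norm_inner_hardy_le f g) (norm_nonneg c)

theorem sa_core (d : ℕ) : NormedSpace.Core ℂ (SA d) where
  norm_nonneg f := norm_SA_nonneg f
  norm_smul c f := by
    refine le_antisymm (norm_SA_smul_le c f) ?_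
    rcases eq_or_ne c 0 with rfl | hc
    · rw [norm_zero, zero_mul]
      exact norm_SA_nonneg _
    have h := norm_SA_smul_le c⁻¹ (c • f)
    rwa [inv_smul_smul₀ hc, norm_inv, ← div_eq_inv_mul, le_div_iff₀' (norm_pos_iff.2 hc)] at h
  norm_triangle f g := by
    refine (norm_SA_le_iff (add_nonneg (norm_SA_nonneg f) (norm_SA_nonneg g))).2 fun k => ?_
    rw [map_add, inner_add_right, add_mul]
    exact norm_add_le_of_le (norm_inner_hardy_le f k) (norm_inner_hardy_le g k)
  norm_eq_zero_iff f := by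
    constructor
    · intro h
      -- Definiteness comes from pairing `f` with itself.
      have h1 := norm_inner_hardy_le f (hardy f)
      rw [h, zero_mul, norm_le_zero_iff, inner_self_eq_zero] at h1
      have h2 := toFun_hardy f
      rw [h1, map_zero] at h2
      exact Subtype.ext h2.symm
    · rintro rfl
      refine le_antisymm ((norm_SA_le_iff le_rfl).2 fun g => ?_) (norm_SA_nonneg _)
      rw [map_zero, inner_zero_right, norm_zero, zero_mul]

theorem hardy_mem_P {n : ℕ} {f : SA d} (hf : f ∈ PSA d n) : hardy f ∈ P d n := by
  obtain ⟨p, hp, hpf⟩ := hf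
  rwa [hardy_eq hpf]

/-! ### The isometric dualities -/

section Duality

/-- This and the next three structures are reducible and built from the same cores as in the main
statement, so the instances there agree with these. -/
noncomputable abbrev normedAddCommGroupH2Star (d : ℕ) : NormedAddCommGroup (H2Star d) :=
  NormedAddCommGroup.ofCore (star_core d)

attribute [local instance] normedAddCommGroupH2Star

noncomputable abbrev normedSpaceH2Star (d : ℕ) : NormedSpace ℂ (H2Star d) :=
  NormedSpace.ofCore (star_core d)

attribute [local instance] normedSpaceH2Star

noncomputable abbrev normedAddCommGroupSA (d : ℕ) : NormedAddCommGroup (SA d) :=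
  NormedAddCommGroup.ofCore (sa_core d)

attribute [local instance] normedAddCommGroupSA

noncomputable abbrev normedSpaceSA (d : ℕ) : NormedSpace ℂ (SA d) :=
  NormedSpace.ofCore (sa_core d)

attribute [local instance] normedSpaceSA

/-- The functional `⟨·, f⟩` on `(H², ‖·‖_*)`. -/
noncomputable def pairing (f : SA d) : StrongDual ℂ (H2Star d) :=
  LinearMap.mkContinuous ((innerSL ℂ (hardy f)).toLinearMap ∘ₗ toStar.symm.toLinearMap) ‖f‖
    fun g => by
      rw [LinearMap.comp_apply]
      change ‖inner ℂ (hardy f) (toStar.symm g)‖ ≤ ‖f‖ * dualSANorm (toStar.symm g)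
      rw [norm_inner_symm]
      exact norm_inner_hardy_le f _

theorem pairing_apply (f : SA d) (g : H2Star d) :
    pairing f g = inner ℂ (hardy f) (toStar.symm g) := rfl

theorem norm_pairing (f : SA d) : ‖pairing f‖ = ‖f‖ := by
  refine le_antisymm (LinearMap.mkContinuous_norm_le _ (norm_SA_nonneg f) _)
    ((norm_SA_le_iff (norm_nonneg _)).2 fun g => ?_)
  rw [norm_inner_symm]
  exact (pairing f).le_opNorm (toStar g)

/-- Since `‖·‖_* ≤ ‖·‖_2`, the functional is continuous on `H²` and the Riesz theorem supplies `h`.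
Its `‖·‖_*`-bound is then precisely the criterion for `h` to have finite Schur--Agler norm. -/
theorem exists_pairing_eq (φ : StrongDual ℂ (H2Star d)) : ∃ f : SA d, pairing f = φ := by
  have hφ : ∀ g : H2 d, ‖φ (toStar g)‖ ≤ ‖φ‖ * dualSANorm g := fun g => φ.le_opNorm (toStar g)
  let ψ : StrongDual ℂ (H2 d) := LinearMap.mkContinuous (φ.toLinearMap ∘ₗ toStar.toLinearMap) ‖φ‖
    fun g => (hφ g).trans (mul_le_mul_of_nonneg_left (dualSANorm_le_norm g) (norm_nonneg φ))
  set h : H2 d := (InnerProductSpace.toDual ℂ (H2 d)).symm ψ with hh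
  have hψ : ∀ g, inner ℂ h g = φ (toStar g) := fun g => InnerProductSpace.toDual_symm_apply
  have hSA : toFun h ∈ SA d := toFun_mem_SA_of_le (norm_nonneg φ) fun g => by
    rw [norm_inner_symm, hψ]
    exact hφ g
  refine ⟨⟨toFun h, hSA⟩, ContinuousLinearMap.ext fun g => ?_⟩
  rw [pairing_apply, hardy_eq rfl, hψ]
  rfl

/-- The duality between the Schur--Agler space and `(H², ‖·‖_*)`. -/
noncomputable def dualityEquiv (d : ℕ) : SA d ≃ₗᵢ⋆[ℂ] StrongDual ℂ (H2Star d) :=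
  LinearIsometryEquiv.ofSurjective
    { toFun := pairing
      map_add' := fun f g => ContinuousLinearMap.ext fun h => by
        rw [add_apply, pairing_apply, pairing_apply, pairing_apply, map_add, inner_add_left]
      map_smul' := fun c f => ContinuousLinearMap.ext fun h => by
        rw [smul_apply, pairing_apply, pairing_apply, map_smul, inner_smul_left]
        rfl
      norm_map' := norm_pairing } exists_pairing_eq

theorem dualityEquiv_apply (f : SA d) (g : H2Star d) :
    dualityEquiv d f g = inner ℂ (hardy f) (toStar.symm g) := rfl

/-- The functional `⟨·, p⟩` on `(P_n, ‖·‖_*)`. -/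
noncomputable def pairingP {n : ℕ} (f : PSA d n) : StrongDual ℂ (PStar d n) :=
  (pairing (f : SA d)).comp (PStar d n).subtypeL

theorem pairingP_apply {n : ℕ} (f : PSA d n) (q : PStar d n) :
    pairingP f q = inner ℂ (hardy (f : SA d)) (toStar.symm (q : H2Star d)) := rfl

theorem norm_pairingP {n : ℕ} (f : PSA d n) : ‖pairingP f‖ = ‖f‖ := by
  refine le_antisymm (ContinuousLinearMap.opNorm_le_bound _ (norm_nonneg f) fun q => ?_) ?_
  · rw [pairingP_apply, norm_inner_symm]
    exact norm_inner_hardy_le (f : SA d) _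
  · change ‖(f : SA d)‖ ≤ _
    -- Restricting the functional to `P_n` loses no norm, because test functions in `P_n` already
    -- determine the Schur--Agler norm of a homogeneous polynomial.
    refine (norm_SA_le_ofReal_iff (norm_nonneg (pairingP f))).2
      ((saNorm_toFun_le_iff_of_mem_P (hardy_mem_P f.2) (norm_nonneg (pairingP f))).2 fun q hq => ?_)
    rw [norm_inner_symm]
    exact (pairingP f).le_opNorm ⟨toStar q, q, hq, rfl⟩

/-- On the finite-dimensional `P_n` continuity for the Hilbert norm is automatic, and the Riesz
representative is a polynomial, hence in the Schur--Agler space. -/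
theorem exists_pairingP_eq {n : ℕ} (φ : StrongDual ℂ (PStar d n)) :
    ∃ f : PSA d n, pairingP f = φ := by
  let ψ : StrongDual ℂ (P d n) := LinearMap.toContinuousLinearMap
    (φ.toLinearMap ∘ₗ (toStar.submoduleMap (P d n)).toLinearMap)
  set p : P d n := (InnerProductSpace.toDual ℂ (P d n)).symm ψ with hp
  have hψ : ∀ q : P d n, inner ℂ (p : H2 d) (q : H2 d) = φ (toStar.submoduleMap (P d n) q) :=
    fun q => InnerProductSpace.toDual_symm_apply (x := q) (y := ψ)
  refine ⟨⟨⟨toFun p, toFun_mem_SA_of_mem_P p.2⟩, p, p.2, rfl⟩, ContinuousLinearMap.ext ?_⟩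
  rintro ⟨_, q, hq, rfl⟩
  rw [pairingP_apply, hardy_eq rfl]
  exact hψ ⟨q, hq⟩

/-- The duality between the homogeneous polynomials of degree `n` with the Schur--Agler norm and
those with the dual Schur--Agler norm. -/
noncomputable def dualityEquivP (d n : ℕ) : PSA d n ≃ₗᵢ⋆[ℂ] StrongDual ℂ (PStar d n) :=
  LinearIsometryEquiv.ofSurjective
    { toFun := pairingP
      map_add' := fun f g => ContinuousLinearMap.ext fun h => by
        rw [add_apply, pairingP_apply, pairingP_apply, pairingP_apply, Submodule.coe_add, map_add,
          inner_add_left]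
      map_smul' := fun c f => ContinuousLinearMap.ext fun h => by
        rw [smul_apply, pairingP_apply, pairingP_apply, Submodule.coe_smul, map_smul,
          inner_smul_left]
        rfl
      norm_map' := norm_pairingP } exists_pairingP_eq

theorem dualityEquivP_apply {n : ℕ} (f : PSA d n) (q : PStar d n) :
    dualityEquivP d n f q = inner ℂ (hardy (f : SA d)) (toStar.symm (q : H2Star d)) := rfl

end Duality

end SchurAgler

theorem mainTheorem2 (d : ℕ) :
    -- `‖·‖_*` is a norm on `H²` (and the Schur--Agler norm is a norm on the Schur--Agler space)
    ∃ (hstar : NormedSpace.Core ℂ (SchurAgler.H2Star d))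
      (hSA : NormedSpace.Core ℂ (SchurAgler.SA d)),
    letI : NormedAddCommGroup (SchurAgler.H2Star d) := NormedAddCommGroup.ofCore hstar
    letI : NormedSpace ℂ (SchurAgler.H2Star d) := NormedSpace.ofCore hstar
    letI : NormedAddCommGroup (SchurAgler.SA d) := NormedAddCommGroup.ofCore hSA
    letI : NormedSpace ℂ (SchurAgler.SA d) := NormedSpace.ofCore hSA
    -- the Schur--Agler norm is the supremum of `|⟨f, g⟩|` over `‖g‖_* ≤ 1`, both possibly infinite
    (∀ f : SchurAgler.H2 d, SchurAgler.saNorm (SchurAgler.toFun f) =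
      ⨆ (g : SchurAgler.H2 d) (_ : SchurAgler.dualSANorm g ≤ 1), ‖inner ℂ g f‖ₑ) ∧
    -- functions in the Schur--Agler space belong to `H²`, and `f ↦ ⟨·, f⟩` is a conjugate-linear
    -- isometric isomorphism onto the dual of `(H², ‖·‖_*)`
    (∀ f : SchurAgler.SA d, ∃ h : SchurAgler.H2 d, SchurAgler.toFun h = f) ∧
    (∃ Φ : SchurAgler.SA d ≃ₗᵢ⋆[ℂ] StrongDual ℂ (SchurAgler.H2Star d),
      ∀ (f : SchurAgler.SA d) (h : SchurAgler.H2 d), SchurAgler.toFun h = f →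
        ∀ g : SchurAgler.H2 d, Φ f (SchurAgler.toStar g) = inner ℂ h g) ∧
    -- homogeneous polynomials
    ∀ n : ℕ,
      (∀ q ∈ SchurAgler.P d n,
        IsGLB (SchurAgler.gauge '' {L | L ∈ SchurAgler.LcGraded d n ∧ SchurAgler.tensorSelf q ≤ L})
          (SchurAgler.dualSANorm q) ∧
        IsGLB (SchurAgler.gauge '' SchurAgler.LcGradedAbove n q) (SchurAgler.dualSANorm q)) ∧
      (∀ p ∈ SchurAgler.P d n, SchurAgler.toFun p ∈ SchurAgler.SA d ∧
        SchurAgler.saNorm (SchurAgler.toFun p) =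
          ⨆ (q : SchurAgler.H2 d) (_ : q ∈ SchurAgler.P d n) (_ : SchurAgler.dualSANorm q ≤ 1),
            ‖inner ℂ q p‖ₑ) ∧
      (∃ Ψ : SchurAgler.PSA d n ≃ₗᵢ⋆[ℂ] StrongDual ℂ (SchurAgler.PStar d n),
        ∀ (f : SchurAgler.PSA d n) (p : SchurAgler.H2 d),
          SchurAgler.toFun p = ((f : SchurAgler.SA d) : SchurAgler.polydisc d → ℂ) →
            ∀ q : SchurAgler.PStar d n,
              Ψ f q = inner ℂ p (SchurAgler.toStar.symm (q : SchurAgler.H2Star d))) := by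

  refine ⟨SchurAgler.star_core d, SchurAgler.sa_core d, fun f => ?_, SchurAgler.exists_hardy,
    ⟨SchurAgler.dualityEquiv d, fun f h hf g => ?_⟩, fun n => ⟨fun q hq => ⟨?_, ?_⟩, fun p hp =>
      ⟨SchurAgler.toFun_mem_SA_of_mem_P hp, ?_⟩,
      ⟨SchurAgler.dualityEquivP d n, fun f p hp q => ?_⟩⟩⟩
  · have h := SchurAgler.eq_iSup_of_le_iff (K := ⊤) (f := f) fun S hS =>
      (SchurAgler.saNorm_toFun_le_iff (f := f) hS).trans
        ⟨fun h g _ => h g, fun h g => h g Submodule.mem_top⟩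
    simpa only [Submodule.mem_top, iSup_pos] using h
  · exact (SchurAgler.dualityEquiv_apply f _).trans (by rw [SchurAgler.hardy_eq hf]; rfl)
  · exact SchurAgler.isGLB_gauge hq (fun L hL => ⟨hL.1.1, hL.2⟩)
      (SchurAgler.LcGradedAbove_subset n q)
  · exact SchurAgler.isGLB_gauge hq (fun L hL => hL.1) subset_rfl
  · exact SchurAgler.eq_iSup_of_le_iff fun S hS => SchurAgler.saNorm_toFun_le_iff_of_mem_P hp hS
  · exact (SchurAgler.dualityEquivP_apply f q).trans (by rw [SchurAgler.hardy_eq hp])
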